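/- Let $k$ be a field and let $0\neq q\in k$ not be a root of unity. Let $H=k_q[x,x^{-1},y]$ be the $k$-algebra generated by $x,x^{-1},y$ with relations $xx^{-1}=x^{-1}x=1$, $yx=qxy$, with the Hopf algebra structure given by $\Delta(x)=x\otimes x$, $\Delta(x^{-1})=x^{-1}\otimes x^{-1}$, $\Delta(y)=y\otimes x+1\otimes y$, $\varepsilon(x)=\varepsilon(x^{-1})=1$, $\varepsilon(y)=0$. Let $H(m)=\operatorname{span}_k\{x^ny^m: n\in\mathbb Z\}$, and let $\mathrm{Aut}_c(H)$ be the group of coalgebra automorphisms of $H$ under composition. Let $\mathrm{Aut}_*(H)$ be the set of $\phi\in\mathrm{Aut}_c(H)$ with $\phi(1)=1$ for which there are $\beta_n\in k$ with $\phi(x^ny)=x^ny+\beta_n(x^{n+1}-x^n)$ for all $n\in\mathbb Z$ (such $\phi$ fix all $x^n$, and they form a subgroup). For $i\ge 1$ let $\mathrm{Aut}_i(H)$ be the subgroup of all $\phi\in\mathrm{Aut}_c(H)$ that fix $H(0)+\cdots+H(i)$ pointwise. Let $\binom{m}{i}_q$ be the Gaussian binomial coefficients, given by $\binom m0_q=\binom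 mm_q=1$ and $\binom mi_q=q^i\binom{m-1}{i}_q+\binom{m-1}{i-1}_q$ for $0<i<m$. Put $\binom{m}{t}_{q,l}=\prod_{i=0}^{l-1}\binom{m-it}{t}_q$, and, for $\beta=(\beta_n)_{n\in\mathbb Z}\in k^{\mathbb Z}$, $\beta_{n,t;m}=\prod_{i=0}^{m-1}\beta_{n+it}$. Let $G_i=(k^{\mathbb Z})^i$ and $G_\infty=(k^{\mathbb Z})^{\mathbb N_+}$ as sets, where $\mathbb N_+=\{1,2,\dots\}$. Theorem 3.13. The subgroup $\mathrm{Aut}_*(H)$ is normal in $\mathrm{Aut}_c(H)$, and so are all $\mathrm{Aut}_i(H)$, $i\ge1$, which are contained in $\mathrm{Aut}_*(H)$. For $s\ge1$ and $\beta\in k^{\mathbb Z}$ there is an automorphism $\phi^{(s)}_\beta\in\mathrm{Aut}_*(H)$ with, for all $n\in\mathbb Z$, $m\ge0$, $$\phi^{(s)}_\beta(x^ny^m)=x^ny^m+\sum_{1\le i\le\lfloor m/s\rfloor}\binom{m}{s}_{q,i}\bigl(\beta_{n,s;i}\,x^{n+is}-\beta_{n,s;i-1}\beta_{n+m-s}\,x^{n+is-s}\bigr)y^{m-is}.$$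 For each $i\ge1$ the map $$\Phi_i:G_i\to\mathrm{Aut}_*(H)/\mathrm{Aut}_i(H),\qquad(\beta^{(1)},\dots,\beta^{(i)})\mapsto\phi^{(1)}_{\beta^{(1)}}\cdots\phi^{(i)}_{\beta^{(i)}}\mathrm{Aut}_i(H),$$ is a bijection; give $G_i$ the group structure for which $\Phi_i$ is an isomorphism. For $i\le j$ the truncation $\psi_i^j:G_j\to G_i$, $(\beta^{(1)},\dots,\beta^{(j)})\mapsto(\beta^{(1)},\dots,\beta^{(i)})$, is then a group homomorphism. Give $G_\infty$ the group structure for which the bijection $$\tau:G_\infty\to\varprojlim G_i,\qquad\beta\mapsto\bigl((\beta^{(1)},\dots,\beta^{(i)})\bigr)_{i\ge1},$$ is an isomorphism. Then $$\mathrm{Aut}_*(H)\cong G_\infty .$$ Explicitly, there is a group isomorphism $\Phi:G_\infty\to\mathrm{Aut}_*(H)$ with $$\Phi(\beta)(x^ny^m)=\phi^{(1)}_{\beta^{(1)}}\cdots\phi^{(m)}_{\beta^{(m)}}(x^ny^m)\qquad(n\in\mathbb Z,\ m\ge0),$$ and for $f\in\mathrm{Aut}_*(H)$ the sequence $\beta=\Phi^{-1}(f)$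 is given recursively by $$\beta^{(i)}_n(x^{n+i}-x^n)=f(x^ny^i)-\phi^{(1)}_{\beta^{(1)}}\cdots\phi^{(i-1)}_{\beta^{(i-1)}}(x^ny^i)\qquad(i\ge1,\ n\in\mathbb Z).$$ The product $\delta=\beta\gamma$ in $G_\infty$ is given recursively by $\delta^{(1)}=\beta^{(1)}+\gamma^{(1)}$ and, for $i\ge1$ and $n\in\mathbb Z$, $$\delta^{(i)}_n(x^{n+i}-x^n)=\phi^{(1)}_{\beta^{(1)}}\cdots\phi^{(i)}_{\beta^{(i)}}\,\phi^{(1)}_{\gamma^{(1)}}\cdots\phi^{(i)}_{\gamma^{(i)}}(x^ny^i)-\phi^{(1)}_{\delta^{(1)}}\cdots\phi^{(i-1)}_{\delta^{(i-1)}}(x^ny^i).$$ (Empty products of automorphisms are the identity.) -/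

import Mathlib

open scoped TensorProduct

noncomputable section

namespace QuantumBorel

universe u

/-! ### The group of coalgebra automorphisms of a coalgebra -/

/-- Coalgebra automorphisms form a group under composition, `f * g = f ∘ g`. -/
instance coalgAutGroup (R C : Type*) [CommSemiring R] [AddCommMonoid C] [Module R C]
    [Coalgebra R C] : Group (C ≃ₗc[R] C) where
  mul f g := g.trans f
  one := CoalgEquiv.refl R C
  inv f := f.symm
  mul_assoc _ _ _ := rfl
  one_mul _ := rfl
  mul_one _ := rfl
  inv_mul_cancel f := CoalgEquiv.ext fun c => f.symm_apply_apply c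

theorem coalgAut_mul_apply {R C : Type*} [CommSemiring R] [AddCommMonoid C] [Module R C]
    [Coalgebra R C] (f g : C ≃ₗc[R] C) (c : C) : (f * g) c = f (g c) := rfl

theorem coalgAut_one_apply {R C : Type*} [CommSemiring R] [AddCommMonoid C] [Module R C]
    [Coalgebra R C] (c : C) : (1 : C ≃ₗc[R] C) c = c := rfl

theorem coalgAut_inv_apply_self {R C : Type*} [CommSemiring R] [AddCommMonoid C] [Module R C]
    [Coalgebra R C] (f : C ≃ₗc[R] C) (c : C) : f⁻¹ (f c) = c := f.symm_apply_apply c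

/-! ### The algebra `k_q[x, x⁻¹, y]` -/

variable {k : Type u} [Field k]

/-- Names of the three generators. -/
inductive Gen : Type
  | x
  | xinv
  | y

/-- The defining relations `x x⁻¹ = 1`, `x⁻¹ x = 1`, `y x = q x y`. -/
inductive Rel (q : kˣ) : FreeAlgebra k Gen → FreeAlgebra k Gen → Prop
  | x_xinv : Rel q (FreeAlgebra.ι k Gen.x * FreeAlgebra.ι k Gen.xinv) 1
  | xinv_x : Rel q (FreeAlgebra.ι k Gen.xinv * FreeAlgebra.ι k Gen.x) 1
  | y_x : Rel q (FreeAlgebra.ι k Gen.y * FreeAlgebra.ι k Gen.x)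
      ((q : k) • (FreeAlgebra.ι k Gen.x * FreeAlgebra.ι k Gen.y))

/-- `H = k_q[x, x⁻¹, y]`, the localized quantum plane, presented by generators and relations. -/
def H (q : kˣ) : Type u := RingQuot (Rel q)

instance (q : kˣ) : Ring (H q) := inferInstanceAs (Ring (RingQuot (Rel q)))

instance (q : kˣ) : Algebra k (H q) := inferInstanceAs (Algebra k (RingQuot (Rel q)))

/-- The class of a generator in `H`. -/
def gen (q : kˣ) (g : Gen) : H q := RingQuot.mkAlgHom k (Rel q) (FreeAlgebra.ι k g)

theorem gen_x_xinv (q : kˣ) : gen q Gen.x * gen q Gen.xinv = 1 := by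
  have h := RingQuot.mkAlgHom_rel k (Rel.x_xinv (q := q))
  rw [map_mul, map_one] at h
  exact h

theorem gen_xinv_x (q : kˣ) : gen q Gen.xinv * gen q Gen.x = 1 := by
  have h := RingQuot.mkAlgHom_rel k (Rel.xinv_x (q := q))
  rw [map_mul, map_one] at h
  exact h

theorem gen_y_x (q : kˣ) :
    gen q Gen.y * gen q Gen.x = (q : k) • (gen q Gen.x * gen q Gen.y) := by
  have h := RingQuot.mkAlgHom_rel k (Rel.y_x (q := q))
  rw [map_mul, map_smul, map_mul] at h
  exact h

/-- The universal property of `H`: elements `X, X', Y` satisfying the relations define an algebra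
map. -/
def lift (q : kˣ) {A : Type*} [Ring A] [Algebra k A] (X X' Y : A)
    (h1 : X * X' = 1) (h2 : X' * X = 1) (h3 : Y * X = (q : k) • (X * Y)) : H q →ₐ[k] A :=
  RingQuot.liftAlgHom k
    ⟨FreeAlgebra.lift k (fun g => match g with
      | Gen.x => X
      | Gen.xinv => X'
      | Gen.y => Y), by
      intro a b hab
      cases hab <;> simp [h1, h2, h3]⟩

theorem lift_gen (q : kˣ) {A : Type*} [Ring A] [Algebra k A] (X X' Y : A)
    (h1 : X * X' = 1) (h2 : X' * X = 1) (h3 : Y * X = (q : k) • (X * Y)) (g : Gen) :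
    lift q X X' Y h1 h2 h3 (gen q g) = (match g with
      | Gen.x => X
      | Gen.xinv => X'
      | Gen.y => Y) := by
  unfold lift gen
  refine (RingQuot.liftAlgHom_mkAlgHom_apply k _ _ _).trans ?_
  simp

theorem algHom_ext (q : kˣ) {A : Type*} [Ring A] [Algebra k A] {f g : H q →ₐ[k] A}
    (h : ∀ a, f (gen q a) = g (gen q a)) : f = g :=
  RingQuot.ringQuot_ext' k f g (FreeAlgebra.hom_ext (funext h))

/-! ### The Hopf algebra structure: `Δ(x) = x ⊗ x`, `Δ(x⁻¹) = x⁻¹ ⊗ x⁻¹`,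
`Δ(y) = y ⊗ x + 1 ⊗ y`, `ε(x) = ε(x⁻¹) = 1`, `ε(y) = 0` -/

/-- The comultiplication. -/
def comulHom (q : kˣ) : H q →ₐ[k] H q ⊗[k] H q :=
  lift q (gen q Gen.x ⊗ₜ gen q Gen.x) (gen q Gen.xinv ⊗ₜ gen q Gen.xinv)
    (gen q Gen.y ⊗ₜ gen q Gen.x + 1 ⊗ₜ gen q Gen.y)
    (by simp [gen_x_xinv, Algebra.TensorProduct.one_def])
    (by simp [gen_xinv_x, Algebra.TensorProduct.one_def])
    (by
      simp only [add_mul, mul_add, Algebra.TensorProduct.tmul_mul_tmul, gen_y_x, one_mul, mul_one,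
        smul_add, TensorProduct.smul_tmul', TensorProduct.tmul_smul])

/-- The counit. -/
def counitHom (q : kˣ) : H q →ₐ[k] k :=
  lift q 1 1 0 (by simp) (by simp) (by simp)

instance instBialgebraH (q : kˣ) : Bialgebra k (H q) :=
  Bialgebra.ofAlgHom (comulHom q) (counitHom q)
    (by
      apply algHom_ext
      intro a
      cases a <;>
        simp [comulHom, lift_gen, TensorProduct.add_tmul, TensorProduct.tmul_add,
          Algebra.TensorProduct.one_def, add_assoc])
    (by
      apply algHom_ext
      intro a
      cases a <;> simp [comulHom, counitHom, lift_gen])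
    (by
      apply algHom_ext
      intro a
      cases a <;> simp [comulHom, counitHom, lift_gen])

/-- `x` as a unit of `H`. -/
def xUnit (q : kˣ) : (H q)ˣ := ⟨gen q Gen.x, gen q Gen.xinv, gen_x_xinv q, gen_xinv_x q⟩

/-- `x ^ n` for an integer `n`. -/
def xpow (q : kˣ) (n : ℤ) : H q := ((xUnit q ^ n : (H q)ˣ) : H q)

/-- The monomial `x ^ n * y ^ m`. -/
def mon (q : kˣ) (n : ℤ) (m : ℕ) : H q := xpow q n * gen q Gen.y ^ m

/-- The homogeneous component `H(m)`, spanned by the `x ^ n * y ^ m`, `n ∈ ℤ`. -/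
def homog (q : kˣ) (m : ℕ) : Submodule k (H q) := Submodule.span k (Set.range fun n => mon q n m)

/-! ### Helper facts -/

theorem comul_gen_x (q : kˣ) :
    Coalgebra.comul (R := k) (gen q Gen.x) = gen q Gen.x ⊗ₜ[k] gen q Gen.x :=
  lift_gen q _ _ _ _ _ _ Gen.x

theorem comul_gen_xinv (q : kˣ) :
    Coalgebra.comul (R := k) (gen q Gen.xinv) = gen q Gen.xinv ⊗ₜ[k] gen q Gen.xinv :=
  lift_gen q _ _ _ _ _ _ Gen.xinv

theorem comul_gen_y (q : kˣ) :
    Coalgebra.comul (R := k) (gen q Gen.y) =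
      gen q Gen.y ⊗ₜ[k] gen q Gen.x + 1 ⊗ₜ[k] gen q Gen.y :=
  lift_gen q _ _ _ _ _ _ Gen.y

theorem counit_gen_y (q : kˣ) : Coalgebra.counit (R := k) (gen q Gen.y) = 0 :=
  lift_gen q _ _ _ _ _ _ Gen.y

theorem xpow_zero (q : kˣ) : xpow q 0 = 1 := by simp [xpow]

theorem mon_zero (q : kˣ) (n : ℤ) : mon q n 0 = xpow q n := by simp [mon]

theorem xpow_add_one (q : kˣ) (n : ℤ) : xpow q (n + 1) = xpow q n * gen q Gen.x := by
  simp [xpow, zpow_add, xUnit]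

theorem comul_xpow (q : kˣ) (n : ℤ) :
    Coalgebra.comul (R := k) (xpow q n) = xpow q n ⊗ₜ[k] xpow q n := by
  have step : ∀ n : ℤ, Coalgebra.comul (R := k) (xpow q (n + 1)) =
      Coalgebra.comul (R := k) (xpow q n) * (gen q Gen.x ⊗ₜ[k] gen q Gen.x) := by
    intro n
    rw [xpow_add_one, Bialgebra.comul_mul, comul_gen_x]
  induction n using Int.induction_on with
  | zero => simp [xpow_zero, Algebra.TensorProduct.one_def]
  | succ n ih => rw [step, ih, xpow_add_one, Algebra.TensorProduct.tmul_mul_tmul]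
  | pred n ih =>
    have h := step (-(n : ℤ) - 1)
    have e : xpow q (-(n : ℤ)) = xpow q (-(n : ℤ) - 1) * gen q Gen.x := by
      rw [← xpow_add_one, sub_add_cancel]
    rw [sub_add_cancel, ih, e, ← Algebra.TensorProduct.tmul_mul_tmul] at h
    have h' := congrArg (· * (gen q Gen.xinv ⊗ₜ[k] gen q Gen.xinv)) h
    simpa [mul_assoc, gen_x_xinv, ← Algebra.TensorProduct.one_def] using h'.symm

theorem comul_xpow_y (q : kˣ) (n : ℤ) :
    Coalgebra.comul (R := k) (mon q n 1) =
      mon q n 1 ⊗ₜ[k] xpow q (n + 1) + xpow q n ⊗ₜ[k] mon q n 1 := by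
  simp [mon, Bialgebra.comul_mul, comul_xpow, comul_gen_y, mul_add, xpow_add_one]

theorem gen_y_ne_zero (q : kˣ) : gen q Gen.y ≠ 0 := by
  intro h
  have hq : (q : k) ≠ 0 := q.ne_zero
  have := lift_gen q (A := Matrix (Fin 2) (Fin 2) k) !![1, 0; 0, (q : k)] !![1, 0; 0, (q : k)⁻¹]
    !![0, 1; 0, 0] (by ext i j; fin_cases i <;> fin_cases j <;> simp)
    (by ext i j; fin_cases i <;> fin_cases j <;> simp)
    (by ext i j; fin_cases i <;> fin_cases j <;> simp) Gen.y
  rw [h, map_zero] at this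
  simpa using congrFun (congrFun this 0) 1

theorem mon_one_ne_zero (q : kˣ) (n : ℤ) : mon q n 1 ≠ 0 := by
  intro h
  rw [mon, pow_one, xpow, Units.mul_right_eq_zero] at h
  exact gen_y_ne_zero q h

theorem tmul_eq_zero_imp {V W : Type*} [AddCommGroup V] [Module k V] [AddCommGroup W]
    [Module k W] {v : V} {w : W} (h : v ⊗ₜ[k] w = 0) : v = 0 ∨ w = 0 := by
  by_contra! hvw
  obtain ⟨f, hf⟩ : ∃ f : Module.Dual k V, f v ≠ 0 := by
    by_contra! hc
    exact hvw.1 ((Module.forall_dual_apply_eq_zero_iff k v).1 hc)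
  have := congrArg (fun t => TensorProduct.lid k W (f.rTensor W t)) h
  simp only [LinearMap.rTensor_tmul, TensorProduct.lid_tmul, map_zero] at this
  exact (smul_eq_zero.1 this).elim hf hvw.2

/-- A coalgebra automorphism with `φ(1) = 1` and `φ(xⁿ y) = xⁿ y + βₙ (xⁿ⁺¹ - xⁿ)` fixes all
`xⁿ`. -/
theorem fixes_xpow (q : kˣ) (φ : H q ≃ₗc[k] H q) (h1 : φ 1 = 1) (β : ℤ → k)
    (h : ∀ n, φ (mon q n 1) = mon q n 1 + β n • (xpow q (n + 1) - xpow q n)) (n : ℤ) :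
    φ (xpow q n) = xpow q n := by
  have hz : ∀ n, φ (mon q n 1) ≠ 0 := fun n h0 =>
    mon_one_ne_zero q n ((EquivLike.injective φ) (h0.trans (map_zero φ).symm))
  have key : ∀ n, (φ (mon q n 1)) ⊗ₜ[k] (φ (xpow q (n + 1)) - xpow q (n + 1)) +
      (φ (xpow q n) - xpow q n) ⊗ₜ[k] (φ (mon q n 1)) = 0 := by
    intro n
    have e1 : Coalgebra.comul (R := k) (φ (mon q n 1)) =
        φ (mon q n 1) ⊗ₜ[k] φ (xpow q (n + 1)) + φ (xpow q n) ⊗ₜ[k] φ (mon q n 1) := by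
      rw [← CoalgHomClass.map_comp_comul_apply, comul_xpow_y]
      simp
    have e2 : Coalgebra.comul (R := k) (φ (mon q n 1)) =
        φ (mon q n 1) ⊗ₜ[k] xpow q (n + 1) + xpow q n ⊗ₜ[k] φ (mon q n 1) := by
      rw [h, map_add, map_smul, map_sub, comul_xpow_y, comul_xpow, comul_xpow]
      simp only [TensorProduct.add_tmul, TensorProduct.tmul_add, TensorProduct.tmul_sub,
        TensorProduct.sub_tmul, smul_sub, TensorProduct.smul_tmul', TensorProduct.tmul_smul]
      abel
    rw [TensorProduct.tmul_sub, TensorProduct.sub_tmul, sub_add_sub_comm, ← e1, ← e2, sub_self]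
  have up : ∀ n, φ (xpow q n) = xpow q n → φ (xpow q (n + 1)) = xpow q (n + 1) := by
    intro n hn
    have := key n
    rw [hn, sub_self, TensorProduct.zero_tmul, add_zero] at this
    exact sub_eq_zero.1 ((tmul_eq_zero_imp this).resolve_left (hz n))
  have down : ∀ n, φ (xpow q (n + 1)) = xpow q (n + 1) → φ (xpow q n) = xpow q n := by
    intro n hn
    have := key n
    rw [hn, sub_self, TensorProduct.tmul_zero, zero_add] at this
    exact sub_eq_zero.1 ((tmul_eq_zero_imp this).resolve_right (hz n))
  induction n using Int.induction_on with
  | zero => rw [xpow_zero, h1]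
  | succ n ih => exact up _ ih
  | pred n ih => exact down _ (by rwa [sub_add_cancel])

/-! ### The subgroups `Aut_*(H)` and `Aut_m(H)` of `Aut_c(H)` -/

/-- `Aut_*(H)`: the coalgebra automorphisms `φ` with `φ(1) = 1` for which there are scalars `βₙ`
with `φ(xⁿ y) = xⁿ y + βₙ (xⁿ⁺¹ - xⁿ)` for all integers `n`. -/
def autStar (q : kˣ) : Subgroup (H q ≃ₗc[k] H q) where
  carrier := {φ | φ 1 = 1 ∧ ∃ β : ℤ → k,
    ∀ n, φ (mon q n 1) = mon q n 1 + β n • (xpow q (n + 1) - xpow q n)}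
  one_mem' := ⟨rfl, 0, fun n => by simp [coalgAut_one_apply]⟩
  mul_mem' := by
    rintro f g ⟨hf1, β, hf⟩ ⟨hg1, γ, hg⟩
    refine ⟨by rw [coalgAut_mul_apply, hg1, hf1], β + γ, fun n => ?_⟩
    rw [coalgAut_mul_apply, hg, map_add, map_smul, map_sub, hf, fixes_xpow q f hf1 β hf,
      fixes_xpow q f hf1 β hf, Pi.add_apply, add_smul, add_assoc]
  inv_mem' := by
    rintro f ⟨hf1, β, hf⟩
    have hx : ∀ n, f⁻¹ (xpow q n) = xpow q n := fun n => by
      conv_lhs => rw [← fixes_xpow q f hf1 β hf n]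
      exact coalgAut_inv_apply_self f _
    refine ⟨by simpa [xpow_zero] using hx 0, -β, fun n => ?_⟩
    have := congrArg (f⁻¹ : H q ≃ₗc[k] H q) (hf n)
    rw [coalgAut_inv_apply_self, map_add, map_smul, map_sub, hx, hx] at this
    rw [Pi.neg_apply, neg_smul, ← sub_eq_add_neg]
    exact eq_sub_of_add_eq this.symm

/-- `Aut_m(H)`: the coalgebra automorphisms that fix `H(0) + ⋯ + H(m)` pointwise. -/
def autFix (q : kˣ) (m : ℕ) : Subgroup (H q ≃ₗc[k] H q) where
  carrier := {φ | ∀ h ∈ ⨆ i ∈ Finset.range (m + 1), homog q i, φ h = h}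
  one_mem' _ _ := rfl
  mul_mem' {f g} hf hg h hh := by rw [coalgAut_mul_apply, hg h hh, hf h hh]
  inv_mem' {f} hf h hh := by
    conv_lhs => rw [← hf h hh]
    exact coalgAut_inv_apply_self f h

/-- `Aut_m(H)` as a subgroup of `Aut_*(H)`. -/
def autFixStar (q : kˣ) (m : ℕ) : Subgroup (autStar q) := (autFix q m).subgroupOf (autStar q)

/-! ### The automorphisms `φ_β^{(s)}` -/

/-- The Gaussian binomial coefficient `(n choose i)_q`. -/
def qBinom (q : k) : ℕ → ℕ → k
  | _, 0 => 1
  | 0, _ + 1 => 0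
  | n + 1, i + 1 => q ^ (i + 1) * qBinom q n (i + 1) + qBinom q n i

/-- `(m choose t)_{q,l} = ∏_{i < l} (m - i t choose t)_q`. -/
def qBinomProd (q : k) (m t l : ℕ) : k := ∏ i ∈ Finset.range l, qBinom q (m - i * t) t

/-- `β_{n,t;m} = ∏_{i < m} β_{n + i t}`. -/
def stepProd (β : ℤ → k) (n : ℤ) (t m : ℕ) : k := ∏ i ∈ Finset.range m, β (n + i * t)

/-- The prescribed value of `φ_β^{(s)}` at `xⁿ yᵐ`, for `s ≥ 1`:
`xⁿ yᵐ + ∑_{1 ≤ i ≤ ⌊m/s⌋} (m choose s)_{q,i}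
  (β_{n,s;i} x^{n+is} - β_{n,s;i-1} β_{n+m-s} x^{n+is-s}) y^{m-is}`. -/
def phiValue (q : kˣ) (s : ℕ) (β : ℤ → k) (n : ℤ) (m : ℕ) : H q :=
  mon q n m + ∑ i ∈ Finset.Icc 1 (m / s), qBinomProd (q : k) m s i •
    (stepProd β n s i • mon q (n + i * s) (m - i * s) -
      (stepProd β n s (i - 1) * β (n + m - s)) • mon q (n + i * s - s) (m - i * s))

/-! ### The sets `G_i` and `G_∞` -/

variable (k) in
/-- The set `G_i = k^ℤ × ⋯ × k^ℤ` (`i` factors); the entry with index `j : Fin i` of a tuple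
`(β^{(1)}, …, β^{(i)})` is `β^{(j+1)}`. It carries no group structure a priori. -/
structure GFin (i : ℕ) : Type u where
  entry : Fin i → ℤ → k

variable (k) in
/-- The set `G_∞` of all sequences `(β^{(1)}, β^{(2)}, …)` in `k^ℤ`. It carries no group structure
a priori. -/
structure GInf : Type u where
  entry : ℕ+ → ℤ → k

/-- `τ_i : G_∞ → G_i`, `(β^{(1)}, β^{(2)}, …) ↦ (β^{(1)}, …, β^{(i)})`. -/
def GInf.trunc (i : ℕ) (β : GInf k) : GFin k i := ⟨fun j => β.entry (Nat.succPNat j)⟩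

/-- `ψ_i^j : G_j → G_i`, `(β^{(1)}, …, β^{(j)}) ↦ (β^{(1)}, …, β^{(i)})` for `i ≤ j`. -/
def GFin.trunc {i j : ℕ} (hij : i ≤ j) (β : GFin k j) : GFin k i :=
  ⟨fun l => β.entry (Fin.castLE hij l)⟩

/-- For a family `φ` of elements `φ s β` of a monoid, the ordered product
`φ 1 β^{(1)} * φ 2 β^{(2)} * ⋯ * φ i β^{(i)}`. -/
def orderedProd {M : Type*} [Monoid M] (φ : ℕ+ → (ℤ → k) → M) {i : ℕ} (β : GFin k i) : M :=
  (List.ofFn fun j : Fin i => φ (Nat.succPNat j) (β.entry j)).prod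

/-- The inverse limit of a system of groups indexed by the positive integers. -/
def inverseLimit {G : ℕ+ → Type*} [∀ i, Group (G i)] (ψ : ∀ i j : ℕ+, i ≤ j → G j →* G i) :
    Subgroup (∀ i, G i) where
  carrier := {g | ∀ i j (hij : i ≤ j), ψ i j hij (g j) = g i}
  one_mem' := by simp
  mul_mem' := by
    intro a b ha hb i j hij
    simp only [Pi.mul_apply, map_mul, ha i j hij, hb i j hij]
  inv_mem' := by
    intro a ha i j hij
    simp only [Pi.inv_apply, map_inv, ha i j hij]

end QuantumBorel

end

open QuantumBorel

/-!
Up to rescaling `xⁿ yᵐ` by the `q`-factorial of `m`, which is nonzero because `q` is not a root of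
unity, the coalgebra `H` is the path coalgebra of the quiver `⋯ → n → n + 1 → ⋯`: the coefficient
of `xᵃ yⁱ ⊗ xᵇ yʲ` in `Δ h` vanishes unless `b = a + i`, in which case it is a nonzero multiple of
the coefficient of `xᵃ yⁱ⁺ʲ` in `h` (`coord₂_comul`). This determines the group-like elements
(`exists_eq_xpow_of_comul`) and the skew-primitive elements (`skewPrimitive_eq`), and shows that
coalgebra automorphisms preserve the filtration by the degree in `y` (`apply_mon_mem_degLT`).
Normality of `Aut_*(H)` and of the `Aut_i(H)` follows.

The map `φ_β^{(s)}` is the coinner automorphism `c ↦ v⁻¹(c₁) c₂ v(c₃)`, where the functional `v`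
has value `1` at `xⁿ` and `-βₙ` at `xⁿ yˢ` and vanishes at the other monomials. Instead of the
convolution inverse one uses the map `c ↦ v(c₁) c₂`: its composite with the prescribed map
telescopes to `c ↦ c₁ v(c₂)` (`convLeft_comp_monLift_phiValue`), and `coinner` then gives the
compatibility with the comultiplication by coassociativity alone.

If two elements of `Aut_*(H)` agree in degree at most `i`, then at `xⁿ yⁱ⁺¹` they differ by a
multiple of `xⁿ⁺ⁱ⁺¹ - xⁿ`, since this difference is essentially skew-primitive
(`exists_apply_mon_succ_of_agree`). On the other hand `φ_β^{(i+1)}` is the identity in degree at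
most `i` and adds `βₙ (xⁿ⁺ⁱ⁺¹ - xⁿ)` to `xⁿ yⁱ⁺¹`. So every element of `Aut_*(H)` is uniquely an
infinite ordered product of the `φ_{β^{(s)}}^{(s)}`, which is a finite product on each monomial
(`bijective_infProd`), and likewise modulo `Aut_i(H)` (`bijective_mk_orderedProd`). The group
structures and homomorphisms are transported along these bijections.
-/

noncomputable section

namespace QuantumBorel

universe u

variable {k : Type u} [Field k]

/-! ### The monomial basis -/

/-- The operator that sends the `(n, m)`-th basis vector to the `(n + d, m)`-th, by which `x ^ d`
acts on monomial coordinates. -/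
def shiftX (k : Type u) [Field k] (d : ℤ) : Module.End k (ℤ × ℕ →₀ k) :=
  Finsupp.linearCombination k fun p => Finsupp.single (p.1 + d, p.2) 1

/-- The operator that sends the `(n, m)`-th basis vector to `qⁿ` times the `(n, m + 1)`-st, by which
`y` acts on monomial coordinates since `y xⁿ = qⁿ xⁿ y`. -/
def shiftY (q : kˣ) : Module.End k (ℤ × ℕ →₀ k) :=
  Finsupp.linearCombination k fun p => Finsupp.single (p.1, p.2 + 1) ((q ^ p.1 : kˣ) : k)

theorem shiftX_single (d n : ℤ) (m : ℕ) (c : k) :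
    shiftX k d (Finsupp.single (n, m) c) = Finsupp.single (n + d, m) c := by
  simp [shiftX]

theorem shiftY_single (q : kˣ) (n : ℤ) (m : ℕ) (c : k) :
    shiftY q (Finsupp.single (n, m) c) = Finsupp.single (n, m + 1) (c * (q ^ n : kˣ)) := by
  simp [shiftY]

/-- The regular representation of `H` in monomial coordinates. -/
def regRep (q : kˣ) : H q →ₐ[k] Module.End k (ℤ × ℕ →₀ k) :=
  lift q (shiftX k 1) (shiftX k (-1)) (shiftY q)
    (by ext ⟨n, m⟩ : 2; simp [shiftX_single])
    (by ext ⟨n, m⟩ : 2; simp [shiftX_single])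
    (by
      ext ⟨n, m⟩ : 2
      simp [shiftX_single, shiftY_single, zpow_add, mul_comm])

theorem regRep_x (q : kˣ) : regRep q (gen q Gen.x) = shiftX k 1 := lift_gen q _ _ _ _ _ _ _

theorem regRep_xinv (q : kˣ) : regRep q (gen q Gen.xinv) = shiftX k (-1) :=
  lift_gen q _ _ _ _ _ _ _

theorem regRep_y (q : kˣ) : regRep q (gen q Gen.y) = shiftY q := lift_gen q _ _ _ _ _ _ _

theorem xpow_add (q : kˣ) (a b : ℤ) : xpow q (a + b) = xpow q a * xpow q b := by
  simp [xpow, zpow_add]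

theorem xpow_one (q : kˣ) : xpow q 1 = gen q Gen.x := by simp [xpow, xUnit]

theorem xpow_neg_one (q : kˣ) : xpow q (-1) = gen q Gen.xinv := by simp [xpow, xUnit]

theorem y_mul_xpow (q : kˣ) (n : ℤ) :
    gen q Gen.y * xpow q n = ((q ^ n : kˣ) : k) • (xpow q n * gen q Gen.y) := by
  have step : ∀ n : ℤ, gen q Gen.y * xpow q n = ((q ^ n : kˣ) : k) • (xpow q n * gen q Gen.y) ↔
      gen q Gen.y * xpow q (n + 1) =
        ((q ^ (n + 1) : kˣ) : k) • (xpow q (n + 1) * gen q Gen.y) := by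
    intro n
    rw [← (xUnit q).mul_left_inj]
    change gen q Gen.y * xpow q n * gen q Gen.x =
      ((q ^ n : kˣ) : k) • (xpow q n * gen q Gen.y) * gen q Gen.x ↔ _
    rw [mul_assoc, ← xpow_add_one, smul_mul_assoc, mul_assoc, gen_y_x, mul_smul_comm, smul_smul,
      ← mul_assoc, ← xpow_add_one, zpow_add, zpow_one, Units.val_mul]
  induction n using Int.induction_on with
  | zero => simp [xpow_zero]
  | succ n ih => exact (step _).1 ih
  | pred n ih => exact (step _).2 (by rwa [sub_add_cancel])

theorem regRep_xpow (q : kˣ) (n a : ℤ) (m : ℕ) (c : k) :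
    regRep q (xpow q n) (Finsupp.single (a, m) c) = Finsupp.single (a + n, m) c := by
  induction n using Int.induction_on generalizing a with
  | zero => simp [xpow_zero]
  | succ n ih =>
    rw [xpow_add, map_mul, Module.End.mul_apply, xpow_one, regRep_x, shiftX_single, ih]
    congr 2; ring
  | pred n ih =>
    rw [sub_eq_add_neg, xpow_add, map_mul, Module.End.mul_apply, xpow_neg_one, regRep_xinv,
      shiftX_single, ih]
    congr 2; ring

theorem regRep_mon (q : kˣ) (n : ℤ) (m : ℕ) :
    regRep q (mon q n m) (Finsupp.single (0, 0) 1) = Finsupp.single (n, m) 1 := by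
  have hy : ∀ m : ℕ, regRep q (gen q Gen.y ^ m) (Finsupp.single (0, 0) 1) =
      Finsupp.single (0, m) 1 := by
    intro m
    induction m with
    | zero => simp
    | succ m ih =>
      rw [pow_succ', map_mul, Module.End.mul_apply, ih, regRep_y, shiftY_single]
      simp
  rw [mon, map_mul, Module.End.mul_apply, hy, regRep_xpow, zero_add]

theorem adjoin_gen (q : kˣ) : Algebra.adjoin k (Set.range (gen q)) = ⊤ := by
  have hm : ∀ g, gen q g ∈ Algebra.adjoin k (Set.range (gen q)) := fun g =>
    Algebra.subset_adjoin ⟨g, rfl⟩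
  let f : H q →ₐ[k] Algebra.adjoin k (Set.range (gen q)) :=
    lift q ⟨_, hm Gen.x⟩ ⟨_, hm Gen.xinv⟩ ⟨_, hm Gen.y⟩ (Subtype.ext (gen_x_xinv q))
      (Subtype.ext (gen_xinv_x q)) (Subtype.ext (gen_y_x q))
  have hf : (Subalgebra.val _).comp f = AlgHom.id k (H q) :=
    algHom_ext q fun a => by cases a <;> simp [f, lift_gen]
  refine Algebra.eq_top_iff.2 fun h => ?_
  rw [← show ((f h : Algebra.adjoin k (Set.range (gen q))) : H q) = h from
    DFunLike.congr_fun hf h]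
  exact (f h).2

/-- `monBasis` is bijective because the regular representation intertwines with left
multiplication. -/
theorem linearCombination_regRep (q : kˣ) (h : H q) (v : ℤ × ℕ →₀ k) :
    Finsupp.linearCombination k (fun p : ℤ × ℕ => mon q p.1 p.2) (regRep q h v) =
      h * Finsupp.linearCombination k (fun p : ℤ × ℕ => mon q p.1 p.2) v := by
  have hh : h ∈ Algebra.adjoin k (Set.range (gen q)) := adjoin_gen q ▸ Algebra.mem_top
  induction hh using Algebra.adjoin_induction generalizing v with
  | algebraMap r => simp [Algebra.algebraMap_eq_smul_one]
  | mem h hh =>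
    obtain ⟨g, rfl⟩ := hh
    induction v using Finsupp.induction_linear with
    | zero => simp
    | add v w hv hw => simp only [map_add, mul_add, hv, hw]
    | single p c =>
      obtain ⟨n, m⟩ := p
      cases g with
      | x =>
        rw [regRep_x, shiftX_single, Finsupp.linearCombination_single,
          Finsupp.linearCombination_single, mul_smul_comm, mon, mon, ← mul_assoc, add_comm,
          xpow_add, xpow_one]
      | xinv =>
        rw [regRep_xinv, shiftX_single, Finsupp.linearCombination_single,
          Finsupp.linearCombination_single, mul_smul_comm, mon, mon, ← mul_assoc, add_comm,
          xpow_add, xpow_neg_one]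
      | y =>
        rw [regRep_y, shiftY_single, Finsupp.linearCombination_single,
          Finsupp.linearCombination_single, mul_smul_comm, mon, mon, ← mul_assoc, y_mul_xpow,
          smul_mul_assoc, smul_smul, pow_succ', mul_assoc]
  | mul a b _ _ ha hb => rw [map_mul, Module.End.mul_apply, mul_assoc, ← hb, ← ha]
  | add a b _ _ ha hb => rw [map_add, LinearMap.add_apply, map_add, add_mul, ← hb, ← ha]

/-- The monomials `xⁿ yᵐ` form a basis of `H`. -/
def monBasis (q : kˣ) : Module.Basis (ℤ × ℕ) k (H q) :=
  .ofRepr <| LinearEquiv.ofLinearMap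
    ((LinearMap.applyₗ (Finsupp.single (0, 0) 1)).comp (regRep q).toLinearMap)
    (Finsupp.linearCombination k fun p : ℤ × ℕ => mon q p.1 p.2)
    (by
      ext ⟨n, m⟩ : 2
      simp [regRep_mon])
    (by
      ext h
      change Finsupp.linearCombination k _ (regRep q h _) = h
      rw [linearCombination_regRep]
      simp [mon, xpow_zero])

theorem monBasis_apply (q : kˣ) (p : ℤ × ℕ) : monBasis q p = mon q p.1 p.2 := by
  simp [monBasis]

/-- The coefficient of `xⁿ yᵐ`. -/
def coord (q : kˣ) (n : ℤ) (m : ℕ) : H q →ₗ[k] k := (monBasis q).coord (n, m)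

theorem coord_mon (q : kˣ) (n a : ℤ) (m i : ℕ) :
    coord q n m (mon q a i) = if a = n ∧ i = m then 1 else 0 := by
  have := (monBasis q).repr_self (a, i)
  rw [monBasis_apply] at this
  simp [coord, this, Finsupp.single_apply]

theorem coord_xpow (q : kˣ) (n a : ℤ) (m : ℕ) :
    coord q n m (xpow q a) = if a = n ∧ 0 = m then 1 else 0 := by
  rw [← mon_zero, coord_mon]

theorem ext_coord (q : kˣ) {g h : H q} (hgh : ∀ n m, coord q n m g = coord q n m h) :
    g = h :=
  (monBasis q).ext_elem fun p => hgh p.1 p.2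

theorem linearMap_ext_mon (q : kˣ) {V : Type*} [AddCommMonoid V] [Module k V]
    {f g : H q →ₗ[k] V} (h : ∀ n m, f (mon q n m) = g (mon q n m)) : f = g :=
  (monBasis q).ext fun p => by simpa [monBasis_apply] using h p.1 p.2

/-- The linear map with prescribed values at the monomials. -/
def monLift (q : kˣ) {V : Type*} [AddCommMonoid V] [Module k V] (v : ℤ → ℕ → V) :
    H q →ₗ[k] V := (monBasis q).constr k fun p => v p.1 p.2

theorem monLift_mon (q : kˣ) {V : Type*} [AddCommMonoid V] [Module k V] (v : ℤ → ℕ → V)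
    (n : ℤ) (m : ℕ) : monLift q v (mon q n m) = v n m := by
  have := (monBasis q).constr_basis k (fun p => v p.1 p.2) (n, m)
  rwa [monBasis_apply] at this

theorem smul_xpow_sub_injective (q : kˣ) {a b : ℤ} (h : a ≠ b) {c d : k}
    (e : c • (xpow q a - xpow q b) = d • (xpow q a - xpow q b)) : c = d := by
  have := congrArg (coord q a 0) e
  simpa [coord_xpow, h.symm] using this

/-! ### Gaussian binomial coefficients -/

theorem qBinom_zero_right (q : k) (n : ℕ) : qBinom q n 0 = 1 := by
  cases n <;> rfl

theorem qBinom_succ_succ (q : k) (n i : ℕ) :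
    qBinom q (n + 1) (i + 1) = q ^ (i + 1) * qBinom q n (i + 1) + qBinom q n i := rfl

theorem qBinom_eq_zero (q : k) {n i : ℕ} (h : n < i) : qBinom q n i = 0 := by
  induction n generalizing i with
  | zero => obtain ⟨i, rfl⟩ := Nat.exists_eq_succ_of_ne_zero h.ne'; rfl
  | succ n ih =>
    obtain ⟨i, rfl⟩ := Nat.exists_eq_succ_of_ne_zero (Nat.ne_zero_of_lt h)
    rw [qBinom_succ_succ, ih (by omega), ih (by omega)]; simp

theorem qBinom_self (q : k) (n : ℕ) : qBinom q n n = 1 := by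
  induction n with
  | zero => rfl
  | succ n ih => rw [qBinom_succ_succ, ih, qBinom_eq_zero q (Nat.lt_succ_self n)]; simp

/-- The `q`-integer `1 + q + ⋯ + q ^ (n - 1)`. -/
def qInt (q : k) (n : ℕ) : k := ∑ i ∈ Finset.range n, q ^ i

/-- The `q`-factorial. -/
def qFact (q : k) (n : ℕ) : k := ∏ i ∈ Finset.range n, qInt q (i + 1)

theorem qFact_succ (q : k) (n : ℕ) : qFact q (n + 1) = qFact q n * qInt q (n + 1) :=
  Finset.prod_range_succ _ _

theorem qInt_add (q : k) (i j : ℕ) : qInt q (i + j) = qInt q i + q ^ i * qInt q j := by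
  simp [qInt, Finset.sum_range_add, Finset.mul_sum, pow_add]

/-- The factorial formula, from which nonvanishing and symmetry follow. -/
theorem qBinom_mul_qFact (q : k) (i j : ℕ) :
    qBinom q (i + j) i * (qFact q i * qFact q j) = qFact q (i + j) := by
  induction i generalizing j with
  | zero => simp [qBinom_zero_right, qFact]
  | succ i ih =>
    induction j with
    | zero => simp [qBinom_self, qFact]
    | succ j ihj =>
      have h1 := ih (j + 1)
      rw [show i + 1 + (j + 1) = (i + 1 + j) + 1 by ring, qBinom_succ_succ, qFact_succ q (i + 1 + j),
        show i + 1 + j + 1 = (i + 1) + (j + 1) by ring, qInt_add]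
      rw [show i + (j + 1) = i + 1 + j by ring] at h1
      rw [qFact_succ q j] at *
      rw [qFact_succ q i] at *
      linear_combination q ^ (i + 1) * qInt q (j + 1) * ihj + qInt q (i + 1) * h1

section NotRootOfUnity

variable {q : kˣ} (hq : ∀ n : ℕ, 0 < n → q ^ n ≠ 1)
include hq

theorem qInt_ne_zero {n : ℕ} (hn : 0 < n) : qInt (q : k) n ≠ 0 := by
  intro h
  have := geom_sum_mul (q : k) n
  rw [show ∑ i ∈ Finset.range n, (q : k) ^ i = 0 from h, zero_mul] at this
  exact hq n hn (Units.ext (by simpa using (sub_eq_zero.1 this.symm)))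

theorem qFact_ne_zero (n : ℕ) : qFact (q : k) n ≠ 0 :=
  Finset.prod_ne_zero_iff.2 fun _ _ => qInt_ne_zero hq (Nat.succ_pos _)

theorem qBinom_add_ne_zero (i j : ℕ) : qBinom (q : k) (i + j) i ≠ 0 := by
  intro h
  have := qBinom_mul_qFact (q : k) i j
  rw [h, zero_mul] at this
  exact qFact_ne_zero hq _ this.symm

theorem qBinom_add_symm (i j : ℕ) : qBinom (q : k) (i + j) i = qBinom (q : k) (i + j) j := by
  have h1 := qBinom_mul_qFact (q : k) i j
  have h2 := qBinom_mul_qFact (q : k) j i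
  rw [add_comm j i, mul_comm (qFact _ j), ← h1] at h2
  exact (mul_right_cancel₀ (mul_ne_zero (qFact_ne_zero hq i) (qFact_ne_zero hq j)) h2).symm

end NotRootOfUnity

/-! ### The comultiplication in monomial coordinates -/

/-- The `q`-binomial theorem for `q`-commuting elements. -/
theorem add_pow_of_qcomm {A : Type*} [Ring A] [Algebra k A] (q : k) {X Y : A}
    (h : Y * X = q • (X * Y)) (m : ℕ) :
    (X + Y) ^ m = ∑ p ∈ Finset.HasAntidiagonal.antidiagonal m, qBinom q m p.1 • (X ^ p.1 * Y ^ p.2) := by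
  have hX : ∀ i, Y * X ^ i = q ^ i • (X ^ i * Y) := by
    intro i
    induction i with
    | zero => simp
    | succ i ih =>
      rw [pow_succ, ← mul_assoc, ih, smul_mul_assoc, mul_assoc, h, mul_smul_comm, smul_smul,
        mul_assoc, pow_succ]
  induction m with
  | zero => simp [qBinom_self]
  | succ m ih =>
    -- the two summands of `X + Y` give the two terms of the recursion for `qBinom`
    have e1 : X * (X + Y) ^ m = ∑ p ∈ Finset.HasAntidiagonal.antidiagonal (m + 1),
        (match p.1 with | 0 => 0 | i + 1 => qBinom q m i) • (X ^ p.1 * Y ^ p.2) := by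
      rw [Finset.Nat.sum_antidiagonal_succ, ih, Finset.mul_sum]
      simp [pow_succ', mul_assoc]
    have e2 : Y * (X + Y) ^ m = ∑ p ∈ Finset.HasAntidiagonal.antidiagonal (m + 1),
        (q ^ p.1 * qBinom q m p.1) • (X ^ p.1 * Y ^ p.2) := by
      rw [Finset.Nat.sum_antidiagonal_succ', ih, Finset.mul_sum,
        qBinom_eq_zero q (Nat.lt_succ_self m), mul_zero, zero_smul, zero_add]
      refine Finset.sum_congr rfl fun p _ => ?_
      rw [mul_smul_comm, ← mul_assoc, hX, smul_mul_assoc, smul_smul, mul_comm (q ^ _), mul_assoc,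
        ← pow_succ']
    rw [pow_succ', add_mul, e1, e2, ← Finset.sum_add_distrib]
    refine Finset.sum_congr rfl fun p _ => ?_
    rw [← add_smul]
    congr 1
    rcases p with ⟨_ | i, j⟩
    · simp [qBinom_zero_right]
    · simp [qBinom_succ_succ, add_comm]

theorem comul_mon (q : kˣ) (n : ℤ) (m : ℕ) :
    Coalgebra.comul (R := k) (mon q n m) = ∑ p ∈ Finset.HasAntidiagonal.antidiagonal m,
      qBinom (q : k) m p.1 • (mon q n p.1 ⊗ₜ[k] mon q (n + p.1) p.2) := by
  have hx : ∀ i : ℕ, xpow q i = gen q Gen.x ^ i := fun i => by simp [xpow, xUnit]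
  have h : (1 ⊗ₜ[k] gen q Gen.y : H q ⊗[k] H q) * (gen q Gen.y ⊗ₜ[k] gen q Gen.x) =
      (q : k) • ((gen q Gen.y ⊗ₜ[k] gen q Gen.x) * (1 ⊗ₜ[k] gen q Gen.y)) := by
    simp [gen_y_x]
  rw [mon, Bialgebra.comul_mul, comul_xpow, Bialgebra.comul_pow, comul_gen_y,
    add_pow_of_qcomm (q : k) h, Finset.mul_sum]
  refine Finset.sum_congr rfl fun p _ => ?_
  rw [mul_smul_comm]
  congr 1
  simp [mon, xpow_add, hx, mul_assoc]

/-! ### The filtration by the degree in `y` -/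

/-- The span of the monomials `xⁿ yⁱ` with `i < m`, described by the vanishing of the other
coefficients. -/
def degLT (q : kˣ) (m : ℕ) : Submodule k (H q) where
  carrier := {h | ∀ n i, m ≤ i → coord q n i h = 0}
  zero_mem' _ _ _ := map_zero _
  add_mem' ha hb n i hi := by rw [map_add, ha n i hi, hb n i hi, add_zero]
  smul_mem' c h hh n i hi := by rw [map_smul, hh n i hi, smul_zero]

theorem mon_mem_degLT (q : kˣ) (n : ℤ) {i m : ℕ} (h : i < m) : mon q n i ∈ degLT q m := by
  intro a j hj
  rw [coord_mon, if_neg]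
  omega

theorem xpow_mem_degLT (q : kˣ) (n : ℤ) {m : ℕ} (h : 0 < m) : xpow q n ∈ degLT q m :=
  mon_zero q n ▸ mon_mem_degLT q n h

theorem degLT_le (q : kˣ) {m : ℕ} {N : Submodule k (H q)} (h : ∀ n, ∀ i < m, mon q n i ∈ N) :
    degLT q m ≤ N := by
  intro v hv
  rw [← (monBasis q).linearCombination_repr v, Finsupp.linearCombination_apply]
  refine N.sum_mem fun p _ => ?_
  by_cases hp : p.2 < m
  · exact N.smul_mem _ (monBasis_apply q p ▸ h _ _ hp)
  · have : (monBasis q).repr v p = 0 := hv p.1 p.2 (not_lt.1 hp)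
    simp only [this, zero_smul]
    exact N.zero_mem

theorem degLT_zero (q : kˣ) : degLT q 0 = ⊥ :=
  le_bot_iff.1 (degLT_le q fun _ _ h => absurd h (Nat.not_lt_zero _))

theorem degLT_mono (q : kˣ) : Monotone (degLT q) := fun _ _ h _ hv n i hi => hv n i (h.trans hi)

theorem exists_mem_degLT (q : kˣ) (h : H q) : ∃ m, h ∈ degLT q m := by
  refine ⟨((monBasis q).repr h).support.sup (fun p => p.2 + 1), fun n i hi => ?_⟩
  by_contra hne
  have := Finset.le_sup (f := fun p : ℤ × ℕ => p.2 + 1)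
    (Finsupp.mem_support_iff.2 (show (monBasis q).repr h (n, i) ≠ 0 from hne))
  simp only at this
  omega

theorem iSup_homog (q : kˣ) (m : ℕ) :
    ⨆ i ∈ Finset.range (m + 1), homog q i = degLT q (m + 1) := by
  refine le_antisymm (iSup₂_le fun i hi => Submodule.span_le.2 ?_) (degLT_le q fun n i hi => ?_)
  · rintro _ ⟨n, rfl⟩
    exact mon_mem_degLT q n (Finset.mem_range.1 hi)
  · exact Submodule.mem_iSup_of_mem i (Submodule.mem_iSup_of_mem (Finset.mem_range.2 hi)
      (Submodule.subset_span ⟨n, rfl⟩))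

theorem mem_autFix (q : kˣ) {m : ℕ} {f : H q ≃ₗc[k] H q} :
    f ∈ autFix q m ↔ ∀ n, ∀ i ≤ m, f (mon q n i) = mon q n i := by
  change (∀ h ∈ ⨆ i ∈ Finset.range (m + 1), homog q i, f h = h) ↔ _
  rw [iSup_homog]
  refine ⟨fun h n i hi => h _ (mon_mem_degLT q n (Nat.lt_succ_of_le hi)), fun h v hv => ?_⟩
  exact degLT_le q (N := LinearMap.eqLocus (f : H q →ₗ[k] H q) LinearMap.id)
    (fun n i hi => h n i (Nat.lt_succ_iff.1 hi)) hv

/-- A unitriangular linear map with respect to the degree in `y` is bijective, since its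
difference from the identity is locally nilpotent. -/
theorem bijective_of_unitriangular (q : kˣ) (T : H q →ₗ[k] H q)
    (hT : ∀ n m, T (mon q n m) - mon q n m ∈ degLT q m) : Function.Bijective T := by
  have hN : ∀ m h, h ∈ degLT q (m + 1) → T h - h ∈ degLT q m := by
    intro m
    refine degLT_le q (N := (degLT q m).comap (T - LinearMap.id)) fun n i hi => ?_
    exact degLT_mono q (Nat.lt_succ_iff.1 hi) (hT n i)
  constructor
  · rw [injective_iff_map_eq_zero]
    intro h hh
    obtain ⟨m, hm⟩ := exists_mem_degLT q h
    induction m with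
    | zero => rwa [degLT_zero, Submodule.mem_bot] at hm
    | succ m ih => exact ih (by simpa [hh] using hN m h hm)
  · intro h
    change h ∈ LinearMap.range T
    obtain ⟨m, hm⟩ := exists_mem_degLT q h
    induction m generalizing h with
    | zero => rw [degLT_zero, Submodule.mem_bot] at hm; rw [hm]; exact Submodule.zero_mem _
    | succ m ih =>
      have := Submodule.sub_mem _ (LinearMap.mem_range_self T h) (ih (T h - h) (hN m h hm))
      rwa [sub_sub_cancel] at this

/-! ### Group-like and skew-primitive elements -/

/-- The functional on `H ⊗ H` reading off the coefficient of `xᵃ yⁱ ⊗ xᵇ yʲ`. -/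
def coord₂ (q : kˣ) (a : ℤ) (i : ℕ) (b : ℤ) (j : ℕ) : H q ⊗[k] H q →ₗ[k] k :=
  LinearMap.mul' k k ∘ₗ TensorProduct.map (coord q a i) (coord q b j)

theorem coord₂_tmul (q : kˣ) (a : ℤ) (i : ℕ) (b : ℤ) (j : ℕ) (g h : H q) :
    coord₂ q a i b j (g ⊗ₜ h) = coord q a i g * coord q b j h := by
  simp [coord₂]

/-- In monomial coordinates, `H` is the path coalgebra of the quiver `⋯ → n → n + 1 → ⋯` up to
the nonzero factors given by the Gaussian binomial coefficients. -/
theorem coord₂_comul (q : kˣ) (a : ℤ) (i : ℕ) (b : ℤ) (j : ℕ) (h : H q) :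
    coord₂ q a i b j (Coalgebra.comul (R := k) h) =
      if b = a + i then qBinom (q : k) (i + j) i * coord q a (i + j) h else 0 := by
  have : coord₂ q a i b j ∘ₗ Coalgebra.comul (R := k) =
      if b = a + i then qBinom (q : k) (i + j) i • coord q a (i + j) else 0 := by
    refine linearMap_ext_mon q fun n m => ?_
    rw [LinearMap.comp_apply, comul_mon, map_sum]
    simp only [map_smul, coord₂_tmul, coord_mon, smul_eq_mul]
    by_cases hm : n = a ∧ m = i + j
    · obtain ⟨rfl, rfl⟩ := hm
      rw [Finset.sum_eq_single (i, j)]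
      · split_ifs with h1 h2 <;> simp_all [coord_mon]
      · rintro ⟨i', j'⟩ hp hne
        rw [if_neg fun h => hne (by
          rw [Finset.HasAntidiagonal.mem_antidiagonal] at hp
          exact Prod.ext h.2 (by have := h.2; omega))]
        simp
      · intro h
        simp [Finset.HasAntidiagonal.mem_antidiagonal] at h
    · rw [Finset.sum_eq_zero]
      · split_ifs
        · simp [coord_mon, hm]
        · simp
      · rintro ⟨i', j'⟩ hp
        simp only [Finset.HasAntidiagonal.mem_antidiagonal] at hp
        by_cases h1 : n = a ∧ i' = i
        · rw [if_neg (c := n + (i' : ℤ) = b ∧ j' = j) fun h => hm ⟨h1.1, by omega⟩]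
          simp
        · simp [h1]
  have := LinearMap.congr_fun this h
  rw [LinearMap.comp_apply] at this
  rw [this]
  split_ifs <;> simp

/-- A group-like element is a power of `x`: the square of its leading coefficient would otherwise
occur in its comultiplication. -/
theorem exists_eq_xpow_of_comul (q : kˣ) {g : H q} (hg : g ≠ 0)
    (h : Coalgebra.comul (R := k) g = g ⊗ₜ[k] g) : ∃ a, g = xpow q a := by
  have key : ∀ a i b j, coord q a i g * coord q b j g =
      if b = a + i then qBinom (q : k) (i + j) i * coord q a (i + j) g else 0 := by
    intro a i b j
    rw [← coord₂_comul, h, coord₂_tmul]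
  obtain ⟨m, hm⟩ := exists_mem_degLT q g
  -- for `m > 0`, `Δ g` has no term `xⁿ yᵐ ⊗ xⁿ yᵐ`, but `g ⊗ g` has the square of a coefficient
  have hdeg : ∀ m, g ∈ degLT q (m + 1) → g ∈ degLT q 1 := by
    intro m
    induction m with
    | zero => exact id
    | succ m ih =>
      intro hm
      refine ih fun n i hi => ?_
      rcases hi.eq_or_lt with rfl | hi
      · have := key n (m + 1) n (m + 1)
        rw [hm n (m + 1 + (m + 1)) (by omega)] at this
        simpa using this
      · exact hm n i hi
  replace hm := hdeg m (degLT_mono q (Nat.le_succ m) hm)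
  obtain ⟨a, ha⟩ : ∃ a, coord q a 0 g ≠ 0 := by
    by_contra! h0
    refine hg (ext_coord q fun n i => ?_)
    rw [map_zero]
    rcases Nat.eq_zero_or_pos i with rfl | hi
    · exact h0 n
    · exact hm n i hi
  have h1 : coord q a 0 g = 1 := by
    have := key a 0 a 0
    simp only [Nat.cast_zero, add_zero, if_true, qBinom_zero_right, one_mul] at this
    exact mul_left_cancel₀ ha (by rw [this, mul_one])
  refine ⟨a, ext_coord q fun n i => ?_⟩
  rw [coord_xpow]
  rcases Nat.eq_zero_or_pos i with rfl | hi
  · by_cases han : a = n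
    · simp [← han, h1]
    · have := key a 0 n 0
      rw [if_neg (by simpa using Ne.symm han), h1, one_mul] at this
      simp [this, han]
  · rw [hm n i hi, if_neg (by omega)]

section NotRootOfUnity

variable {q : kˣ} (hq : ∀ n : ℕ, 0 < n → q ^ n ≠ 1)
include hq

/-- The skew-primitive elements are the multiples of `x ^ b - x ^ a`, together with those of
`x ^ a * y` if `b = a + 1`. -/
theorem skewPrimitive_eq {d : H q} {a b : ℤ}
    (h : Coalgebra.comul (R := k) d = d ⊗ₜ[k] xpow q b + xpow q a ⊗ₜ[k] d) :
    ∃ α γ : k, d = α • mon q a 1 + γ • (xpow q b - xpow q a) ∧ (b ≠ a + 1 → α = 0) := by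
  have key : ∀ (c : ℤ) (i : ℕ) (e : ℤ) (j : ℕ), (if e = c + i then qBinom (q : k) (i + j) i * coord q c (i + j) d else 0) =
      coord q c i d * (if b = e ∧ 0 = j then 1 else 0) +
        (if a = c ∧ 0 = i then 1 else 0) * coord q e j d := by
    intro c i e j
    rw [← coord₂_comul, h, map_add, coord₂_tmul, coord₂_tmul, coord_xpow, coord_xpow]
  have hdeg : ∀ c i, coord q c (i + 2) d = 0 := by
    intro c i
    -- both terms on the right hand side have a tensor factor of degree zero
    have := key c (i + 1) (c + (i + 1 : ℕ)) 1
    simp only [if_true, show (0 : ℕ) ≠ 1 by omega, show (0 : ℕ) ≠ i + 1 by omega, and_false,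
      if_false, mul_zero, zero_mul, add_zero] at this
    exact (mul_eq_zero.1 this).resolve_left (qBinom_add_ne_zero hq _ _)
  -- a term `x^c y` of `d` needs `x^c y ⊗ x^b` and `x^a ⊗ x^c y` in `Δ d`, so `c + 1 = b`, `c = a`
  have h1b : ∀ c, b ≠ c + 1 → coord q c 1 d = 0 := by
    intro c hc
    have := key c 1 (c + 1) 0
    simpa [hc, qBinom_self] using this
  have h1a : ∀ c, a ≠ c → coord q c 1 d = 0 := by
    intro c hc
    have := key c 0 c 1
    simpa [hc, qBinom_zero_right] using this
  have h0 : ∀ c, a ≠ c → b ≠ c → coord q c 0 d = 0 := by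
    intro c hac hbc
    have := key c 0 c 0
    simpa [hac, hbc, qBinom_zero_right] using this
  have hab : coord q a 0 d = if a = b then 0 else - coord q b 0 d := by
    have := key a 0 b 0
    split_ifs with hab
    · subst hab
      simpa [qBinom_zero_right] using this
    · have hba : ¬ b = a := fun h => hab h.symm
      simp only [Nat.cast_zero, add_zero, hba, if_false, and_self, if_true, mul_one,
        one_mul] at this
      linear_combination -this
  refine ⟨coord q a 1 d, coord q b 0 d, ext_coord q fun n i => ?_, fun hne => h1b a hne⟩
  simp only [map_add, map_smul, map_sub, coord_mon, coord_xpow, smul_eq_mul]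
  rcases i with _ | _ | i
  · by_cases han : a = n
    · subst han
      rw [hab]
      by_cases hab' : a = b
      · simp [hab']
      · simp [hab', Ne.symm hab']
    · by_cases hbn : b = n
      · subst hbn
        simp [han]
      · simp [han, hbn, h0 n han hbn]
  · by_cases han : a = n
    · simp [han]
    · simp [han, h1a n han]
  · simp [hdeg]

/-! ### Coalgebra automorphisms and the filtration -/

omit hq in
theorem comul_apply_mon (f : H q ≃ₗc[k] H q) (n : ℤ) (m : ℕ) :
    Coalgebra.comul (R := k) (f (mon q n m)) = ∑ p ∈ Finset.HasAntidiagonal.antidiagonal m,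
      qBinom (q : k) m p.1 • (f (mon q n p.1) ⊗ₜ[k] f (mon q (n + p.1) p.2)) := by
  rw [← CoalgHomClass.map_comp_comul_apply, comul_mon, map_sum]
  simp

omit hq in
theorem exists_apply_xpow (f : H q ≃ₗc[k] H q) (n : ℤ) : ∃ a, f (xpow q n) = xpow q a := by
  have h0 : xpow q n ≠ 0 := fun h => by simpa [coord_xpow] using congrArg (coord q n 0) h
  refine exists_eq_xpow_of_comul q
    (fun h => h0 ((EquivLike.injective f) (h.trans (map_zero f).symm))) ?_
  rw [← CoalgHomClass.map_comp_comul_apply, comul_xpow]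
  simp

/-- Coalgebra automorphisms preserve the filtration: a too large leading coefficient of
`f (xⁿ yᵐ)` would be visible in the comultiplication, in front of a monomial with right hand
tensor factor of degree one. -/
theorem apply_mon_mem_degLT (f : H q ≃ₗc[k] H q) (n : ℤ) (m : ℕ) :
    f (mon q n m) ∈ degLT q (m + 1) := by
  induction m using Nat.strong_induction_on generalizing n with
  | _ m ih =>
  rcases Nat.eq_zero_or_pos m with rfl | hm
  · obtain ⟨a, ha⟩ := exists_apply_xpow f n
    rw [mon_zero, ha]
    exact xpow_mem_degLT q a one_pos
  intro a M hM
  obtain ⟨M, rfl⟩ := Nat.exists_eq_add_one_of_ne_zero (by omega : M ≠ 0)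
  have h := coord₂_comul q a M (a + M) 1 (f (mon q n m))
  rw [if_pos rfl, comul_apply_mon, map_sum, Finset.sum_eq_zero] at h
  · exact (mul_eq_zero.1 h.symm).resolve_left (qBinom_add_ne_zero hq _ _)
  rintro ⟨i, j⟩ hp
  simp only [Finset.HasAntidiagonal.mem_antidiagonal] at hp
  rw [map_smul, coord₂_tmul]
  rcases Nat.eq_zero_or_pos j with rfl | hj
  · obtain ⟨c, hc⟩ := exists_apply_xpow f (n + i)
    simp [mon_zero, hc, coord_xpow]
  · rw [ih i (by omega) n a M (by omega)]
    simp

theorem apply_mem_degLT (f : H q ≃ₗc[k] H q) {m : ℕ} {h : H q} (hh : h ∈ degLT q m) :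
    f h ∈ degLT q m :=
  degLT_le q (N := (degLT q m).comap (f : H q →ₗ[k] H q))
    (fun n i hi => degLT_mono q hi (apply_mon_mem_degLT hq f n i)) hh

theorem normal_autFix (m : ℕ) : (autFix q m).Normal := by
  refine ⟨fun f hf g h hh => ?_⟩
  have : g⁻¹ h ∈ ⨆ i ∈ Finset.range (m + 1), homog q i := by
    rw [iSup_homog] at hh ⊢
    exact apply_mem_degLT hq _ hh
  rw [coalgAut_mul_apply, coalgAut_mul_apply, hf _ this]
  exact coalgAut_inv_apply_self g⁻¹ h

/-- The restriction of a coalgebra automorphism to degree at most one: its action on the powers of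
`x` commutes with multiplication by `x`, because the `xⁿ y` are skew-primitive. -/
theorem exists_apply_mon_one (f : H q ≃ₗc[k] H q) (n : ℤ) : ∃ (a : ℤ) (α γ : k),
    f (xpow q n) = xpow q a ∧ f (xpow q (n + 1)) = xpow q (a + 1) ∧
      f (mon q n 1) = α • mon q a 1 + γ • (xpow q (a + 1) - xpow q a) := by
  obtain ⟨a, ha⟩ := exists_apply_xpow f n
  obtain ⟨b, hb⟩ := exists_apply_xpow f (n + 1)
  have h : Coalgebra.comul (R := k) (f (mon q n 1)) =
      f (mon q n 1) ⊗ₜ[k] xpow q b + xpow q a ⊗ₜ[k] f (mon q n 1) := by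
    rw [← CoalgHomClass.map_comp_comul_apply, comul_xpow_y]
    simp [ha, hb]
  obtain ⟨α, γ, e, hα⟩ := skewPrimitive_eq hq h
  obtain rfl : b = a + 1 := by
    by_contra hne
    -- otherwise `f (xⁿ y)` would be the image of a combination of powers of `x`
    rw [hα hne, zero_smul, zero_add, ← ha, ← hb, ← map_sub, ← map_smul] at e
    have := congrArg (coord q n 1) ((EquivLike.injective f) e)
    simp [coord_mon, coord_xpow] at this
  exact ⟨a, α, γ, ha, hb, e⟩

theorem normal_autStar : (autStar q).Normal := by
  refine ⟨?_⟩
  rintro g ⟨hg1, β, hg⟩ f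
  have hgx := fixes_xpow q g hg1 β hg
  have hff : ∀ h, f (f⁻¹ h) = h := coalgAut_inv_apply_self f⁻¹
  choose τ α γ h0 h1 h2 using exists_apply_mon_one hq f⁻¹
  refine ⟨?_, fun n => α n * β (τ n), fun n => ?_⟩
  · rw [coalgAut_mul_apply, coalgAut_mul_apply, ← xpow_zero, h0, hgx, ← h0, hff]
  · have e : g (f⁻¹ (mon q n 1)) =
        f⁻¹ (mon q n 1) + (α n * β (τ n)) • (f⁻¹ (xpow q (n + 1)) - f⁻¹ (xpow q n)) := by
      rw [h2, h1, h0]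
      simp only [map_add, map_smul, map_sub, hgx, hg, smul_add, mul_smul]
      abel
    rw [coalgAut_mul_apply, coalgAut_mul_apply, e, map_add, map_smul, map_sub, hff, hff, hff]

omit hq in
theorem autFix_le_autStar {m : ℕ} (hm : 0 < m) : autFix q m ≤ autStar q := by
  intro f hf
  rw [mem_autFix] at hf
  refine ⟨?_, 0, fun n => ?_⟩
  · simpa [mon_zero, xpow_zero] using hf 0 0 (Nat.zero_le _)
  · simpa using hf n 1 hm

end NotRootOfUnity

/-! ### Coinner automorphisms of a coalgebra -/

section Convolution

variable {R C : Type*} [CommRing R] [AddCommGroup C] [Module R C] [Coalgebra R C]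

/-- The map `c ↦ v(c₁) c₂`. -/
def convLeft (v : C →ₗ[R] R) : C →ₗ[R] C :=
  (TensorProduct.lid R C).toLinearMap ∘ₗ v.rTensor C ∘ₗ Coalgebra.comul

/-- The map `c ↦ c₁ v(c₂)`. -/
def convRight (v : C →ₗ[R] R) : C →ₗ[R] C :=
  (TensorProduct.rid R C).toLinearMap ∘ₗ v.lTensor C ∘ₗ Coalgebra.comul

theorem comul_comp_convLeft (v : C →ₗ[R] R) :
    Coalgebra.comul ∘ₗ convLeft v = (convLeft v).rTensor C ∘ₗ Coalgebra.comul := by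
  let G : C ⊗[R] (C ⊗[R] C) →ₗ[R] C ⊗[R] C :=
    (TensorProduct.lid R (C ⊗[R] C)).toLinearMap ∘ₗ v.rTensor (C ⊗[R] C)
  have h1 : Coalgebra.comul ∘ₗ (TensorProduct.lid R C).toLinearMap ∘ₗ v.rTensor C =
      G ∘ₗ (Coalgebra.comul (R := R) (A := C)).lTensor C := TensorProduct.ext' fun a b => by simp [G]
  have h2 : G ∘ₗ (TensorProduct.assoc R C C C).toLinearMap =
      ((TensorProduct.lid R C).toLinearMap ∘ₗ v.rTensor C).rTensor C :=
    TensorProduct.ext_threefold fun a b c => by simp [G, TensorProduct.smul_tmul']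
  have h3 : (convLeft v).rTensor C = (G ∘ₗ (TensorProduct.assoc R C C C).toLinearMap) ∘ₗ
      (Coalgebra.comul (R := R) (A := C)).rTensor C := by
    rw [h2, ← LinearMap.rTensor_comp]; rfl
  rw [h3, LinearMap.comp_assoc, LinearMap.comp_assoc, Coalgebra.coassoc, ← LinearMap.comp_assoc,
    ← h1]
  rfl

theorem comul_comp_convRight (v : C →ₗ[R] R) :
    Coalgebra.comul ∘ₗ convRight v = (convRight v).lTensor C ∘ₗ Coalgebra.comul := by
  let G : C ⊗[R] (C ⊗[R] C) →ₗ[R] C ⊗[R] C :=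
    ((TensorProduct.rid R C).toLinearMap ∘ₗ v.lTensor C).lTensor C
  have h0 : ∀ b, G ∘ₗ (TensorProduct.assoc R C C C).toLinearMap ∘ₗ
      (TensorProduct.mk R (C ⊗[R] C) C).flip b = v b • LinearMap.id := fun b =>
    TensorProduct.ext' fun x y => by simp [G]
  have h1 : Coalgebra.comul ∘ₗ (TensorProduct.rid R C).toLinearMap ∘ₗ v.lTensor C =
      (G ∘ₗ (TensorProduct.assoc R C C C).toLinearMap) ∘ₗ
        (Coalgebra.comul (R := R) (A := C)).rTensor C := TensorProduct.ext' fun a b => by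
    simpa using (LinearMap.congr_fun (h0 b) (Coalgebra.comul a)).symm
  have h3 : (convRight v).lTensor C = G ∘ₗ (Coalgebra.comul (R := R) (A := C)).lTensor C := by
    rw [← LinearMap.lTensor_comp]; rfl
  rw [h3, LinearMap.comp_assoc, ← Coalgebra.coassoc, ← LinearMap.comp_assoc,
    ← LinearMap.comp_assoc, ← h1]
  rfl

theorem rTensor_convRight_comp_comul (v : C →ₗ[R] R) :
    (convRight v).rTensor C ∘ₗ Coalgebra.comul = (convLeft v).lTensor C ∘ₗ Coalgebra.comul := by
  let G : C ⊗[R] (C ⊗[R] C) →ₗ[R] C ⊗[R] C :=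
    ((TensorProduct.lid R C).toLinearMap ∘ₗ v.rTensor C).lTensor C
  have h2 : G ∘ₗ (TensorProduct.assoc R C C C).toLinearMap =
      ((TensorProduct.rid R C).toLinearMap ∘ₗ v.lTensor C).rTensor C :=
    TensorProduct.ext_threefold fun a b c => by simp [G, TensorProduct.smul_tmul']
  have h3 : (convRight v).rTensor C = (G ∘ₗ (TensorProduct.assoc R C C C).toLinearMap) ∘ₗ
      (Coalgebra.comul (R := R) (A := C)).rTensor C := by
    rw [h2, ← LinearMap.rTensor_comp]; rfl
  have h4 : (convLeft v).lTensor C = G ∘ₗ (Coalgebra.comul (R := R) (A := C)).lTensor C := by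
    rw [← LinearMap.lTensor_comp]; rfl
  rw [h3, h4, LinearMap.comp_assoc, LinearMap.comp_assoc, Coalgebra.coassoc, LinearMap.comp_assoc]

theorem convLeft_comp_convRight (v : C →ₗ[R] R) :
    convLeft v ∘ₗ convRight v = convRight v ∘ₗ convLeft v := by
  have h : ((TensorProduct.lid R C).toLinearMap ∘ₗ v.rTensor C) ∘ₗ (convRight v).lTensor C =
      convRight v ∘ₗ (TensorProduct.lid R C).toLinearMap ∘ₗ v.rTensor C :=
    TensorProduct.ext' fun a b => by simp
  calc convLeft v ∘ₗ convRight v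
      = ((TensorProduct.lid R C).toLinearMap ∘ₗ v.rTensor C) ∘ₗ
          (Coalgebra.comul ∘ₗ convRight v) := rfl
    _ = convRight v ∘ₗ convLeft v := by
      rw [comul_comp_convRight, ← LinearMap.comp_assoc, h]; rfl

theorem counit_comp_convLeft (v : C →ₗ[R] R) : Coalgebra.counit ∘ₗ convLeft v = v := by
  have h : Coalgebra.counit ∘ₗ (TensorProduct.lid R C).toLinearMap ∘ₗ v.rTensor C =
      v ∘ₗ (TensorProduct.rid R C).toLinearMap ∘ₗ (Coalgebra.counit (R := R) (A := C)).lTensor C :=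
    TensorProduct.ext' fun a b => by simp [mul_comm]
  ext c
  have := LinearMap.congr_fun h (Coalgebra.comul c)
  simp only [LinearMap.comp_apply, Coalgebra.lTensor_counit_comul] at this
  simpa [convLeft] using this

theorem counit_comp_convRight (v : C →ₗ[R] R) : Coalgebra.counit ∘ₗ convRight v = v := by
  have h : Coalgebra.counit ∘ₗ (TensorProduct.rid R C).toLinearMap ∘ₗ v.lTensor C =
      v ∘ₗ (TensorProduct.lid R C).toLinearMap ∘ₗ (Coalgebra.counit (R := R) (A := C)).rTensor C :=
    TensorProduct.ext' fun a b => by simp [mul_comm]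
  ext c
  have := LinearMap.congr_fun h (Coalgebra.comul c)
  simp only [LinearMap.comp_apply, Coalgebra.rTensor_counit_comul] at this
  simpa [convRight] using this

/-- If `c ↦ v(c₁) c₂` and `c ↦ c₁ v(c₂)` are bijective, then the inverse of the first composed
with the second is a coalgebra automorphism, namely `c ↦ v⁻¹(c₁) c₂ v(c₃)` for the convolution
inverse `v⁻¹`. The composite is supplied as `F`, so that its values are known by definition. -/
def coinner (v : C →ₗ[R] R) (hL : Function.Bijective (convLeft v))
    (hR : Function.Bijective (convRight v)) (F : C →ₗ[R] C)
    (hF : convLeft v ∘ₗ F = convRight v) : C ≃ₗc[R] C :=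
  have hFL : F ∘ₗ convLeft v = convRight v := by
    ext c
    apply hL.1
    have h1 := LinearMap.congr_fun hF (convLeft v c)
    have h2 := LinearMap.congr_fun (convLeft_comp_convRight v) c
    exact h1.trans h2.symm
  have hinj : Function.Injective ((convLeft v).rTensor C) := by
    have := (LinearEquiv.rTensor C (LinearEquiv.ofBijective _ hL)).injective
    exact this
  CoalgEquiv.ofBijective
    (f := ({ F with
      counit_comp := by
        ext c
        obtain ⟨c, rfl⟩ := hL.2 c
        have h1 := LinearMap.congr_fun hFL c
        have h2 := LinearMap.congr_fun (counit_comp_convLeft v) c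
        have h3 := LinearMap.congr_fun (counit_comp_convRight v) c
        simp only [LinearMap.comp_apply] at h1 h2 h3
        change Coalgebra.counit (F (convLeft v c)) = _
        rw [h1, h2, h3]
      map_comp_comul := by
        have e : (convLeft v).rTensor C ∘ₗ (TensorProduct.map F F ∘ₗ Coalgebra.comul) =
            (convLeft v).rTensor C ∘ₗ (Coalgebra.comul ∘ₗ F) := by
          have e1 : (convLeft v).rTensor C ∘ₗ (TensorProduct.map F F ∘ₗ Coalgebra.comul) =
              F.lTensor C ∘ₗ (convRight v).rTensor C ∘ₗ Coalgebra.comul := by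
            rw [← LinearMap.comp_assoc, ← LinearMap.comp_assoc, LinearMap.rTensor_comp_map, hF,
              LinearMap.lTensor_comp_rTensor]
          have e2 : (convLeft v).rTensor C ∘ₗ (Coalgebra.comul ∘ₗ F) =
              (convRight v).lTensor C ∘ₗ Coalgebra.comul := by
            rw [← LinearMap.comp_assoc, ← comul_comp_convLeft, LinearMap.comp_assoc, hF,
              comul_comp_convRight]
          rw [e1, e2, rTensor_convRight_comp_comul, ← LinearMap.comp_assoc,
            ← LinearMap.lTensor_comp, hFL]
        ext c
        exact hinj (LinearMap.congr_fun e c) } : C →ₗc[R] C))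
    (by
      have h : Function.Bijective (convLeft v ∘ F) := by
        rw [← LinearMap.coe_comp, hF]; exact hR
      exact (Function.Bijective.of_comp_iff' hL F).1 h)

theorem coinner_apply (v : C →ₗ[R] R) (hL : Function.Bijective (convLeft v))
    (hR : Function.Bijective (convRight v)) (F : C →ₗ[R] C)
    (hF : convLeft v ∘ₗ F = convRight v) (c : C) : coinner v hL hR F hF c = F c := rfl

end Convolution

/-! ### The automorphisms `φ_β^{(s)}` -/

/-- The functional with value `1` at `xⁿ`, value `-βₙ` at `xⁿ yˢ` and value `0` at the other
monomials, of which `φ_β^{(s)}` is the coinner automorphism. -/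
def stepFunctional (q : kˣ) (s : ℕ) (β : ℤ → k) : H q →ₗ[k] k :=
  monLift q fun n m => if m = 0 then 1 else if m = s then - β n else 0

theorem stepFunctional_mon (q : kˣ) (s : ℕ) (β : ℤ → k) (n : ℤ) (m : ℕ) :
    stepFunctional q s β (mon q n m) = if m = 0 then 1 else if m = s then - β n else 0 :=
  monLift_mon q _ n m

/-- Of the sum for `v(c₁) c₂` only the terms with `c₁` a multiple of `xⁿ` or `xⁿ yˢ` survive. For
`m < s` the truncated exponent is harmless, as the Gaussian binomial coefficient vanishes. -/
theorem convLeft_mon (q : kˣ) {s : ℕ} (hs : 0 < s) (β : ℤ → k) (n : ℤ) (m : ℕ) :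
    convLeft (stepFunctional q s β) (mon q n m) =
      mon q n m - (qBinom (q : k) m s * β n) • mon q (n + s) (m - s) := by
  have e : convLeft (stepFunctional q s β) (mon q n m) =
      ∑ p ∈ Finset.HasAntidiagonal.antidiagonal m,
        (qBinom (q : k) m p.1 * (if p.1 = 0 then 1 else if p.1 = s then - β n else 0)) •
          mon q (n + p.1) p.2 := by
    simp only [convLeft, LinearMap.comp_apply, comul_mon, map_sum, map_smul,
      LinearMap.rTensor_tmul, LinearEquiv.coe_coe, TensorProduct.lid_tmul, stepFunctional_mon,
      smul_smul]
  rw [e, Finset.Nat.sum_antidiagonal_eq_sum_range_succ_mk, Finset.sum_range_succ']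
  simp only [qBinom_zero_right, if_true, Nat.succ_ne_zero, if_false, Nat.cast_zero, add_zero,
    Nat.sub_zero, mul_one, one_smul]
  rw [add_comm, sub_eq_add_neg]
  congr 1
  obtain ⟨s, rfl⟩ := Nat.exists_eq_add_one_of_ne_zero hs.ne'
  by_cases hm : s < m
  · rw [Finset.sum_eq_single s]
    · simp
    · intro i _ hi
      simp [hi]
    · intro h
      exact absurd (Finset.mem_range.2 hm) h
  · rw [Finset.sum_eq_zero, qBinom_eq_zero _ (by omega)]
    · simp
    · intro i hi
      rw [Finset.mem_range] at hi
      rw [if_neg (by omega)]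
      simp

theorem convRight_mon {q : kˣ} (hq : ∀ n : ℕ, 0 < n → q ^ n ≠ 1) {s : ℕ} (hs : 0 < s)
    (β : ℤ → k) (n : ℤ) (m : ℕ) :
    convRight (stepFunctional q s β) (mon q n m) =
      mon q n m - (qBinom (q : k) m s * β (n + m - s)) • mon q n (m - s) := by
  have e : convRight (stepFunctional q s β) (mon q n m) =
      ∑ p ∈ Finset.HasAntidiagonal.antidiagonal m,
        (qBinom (q : k) m p.1 *
          (if p.2 = 0 then 1 else if p.2 = s then - β (n + p.1) else 0)) • mon q n p.1 := by
    simp only [convRight, LinearMap.comp_apply, comul_mon, map_sum, map_smul,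
      LinearMap.lTensor_tmul, LinearEquiv.coe_coe, TensorProduct.rid_tmul, stepFunctional_mon,
      smul_smul]
  rw [e, Finset.Nat.sum_antidiagonal_eq_sum_range_succ_mk, Finset.sum_range_succ]
  simp only [qBinom_self, if_true, Nat.sub_self, mul_one, one_smul]
  rw [add_comm, sub_eq_add_neg]
  congr 1
  by_cases hm : s ≤ m
  · obtain ⟨j, rfl⟩ := Nat.exists_eq_add_of_le hm
    rw [Finset.sum_eq_single j]
    · rw [if_neg (by omega), if_pos (by omega), Nat.add_sub_cancel_left, mul_neg, neg_smul,
        qBinom_add_symm hq]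
      congr 4
      push_cast; ring
    · intro i hi hij
      rw [Finset.mem_range] at hi
      rw [if_neg (by omega), if_neg (by omega), mul_zero, zero_smul]
    · intro h
      exact absurd (Finset.mem_range.2 (by omega)) h
  · rw [Finset.sum_eq_zero, qBinom_eq_zero _ (by omega)]
    · simp
    · intro i hi
      rw [Finset.mem_range] at hi
      rw [if_neg (by omega), if_neg (by omega)]
      simp

theorem smul_mon_sub_mem_degLT (q : kˣ) {s : ℕ} (hs : 0 < s) (m : ℕ) (c : k) (a : ℤ) :
    (qBinom (q : k) m s * c) • mon q a (m - s) ∈ degLT q m := by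
  by_cases hm : s ≤ m
  · exact Submodule.smul_mem _ _ (mon_mem_degLT q a (by omega))
  · rw [qBinom_eq_zero _ (by omega), zero_mul, zero_smul]
    exact Submodule.zero_mem _

theorem bijective_convLeft (q : kˣ) {s : ℕ} (hs : 0 < s) (β : ℤ → k) :
    Function.Bijective (convLeft (stepFunctional q s β)) := by
  refine bijective_of_unitriangular q _ fun n m => ?_
  rw [convLeft_mon q hs, sub_sub_cancel_left]
  exact Submodule.neg_mem _ (smul_mon_sub_mem_degLT q hs m _ _)

theorem bijective_convRight {q : kˣ} (hq : ∀ n : ℕ, 0 < n → q ^ n ≠ 1) {s : ℕ} (hs : 0 < s)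
    (β : ℤ → k) : Function.Bijective (convRight (stepFunctional q s β)) := by
  refine bijective_of_unitriangular q _ fun n m => ?_
  rw [convRight_mon hq hs, sub_sub_cancel_left]
  exact Submodule.neg_mem _ (smul_mon_sub_mem_degLT q hs m _ _)

/-- The `i`-th term of the geometric series that inverts `convLeft (stepFunctional q s β)` at
`xⁿ yᵐ`. -/
def geomTerm (q : kˣ) (s : ℕ) (β : ℤ → k) (n : ℤ) (m i : ℕ) : H q :=
  (qBinomProd (q : k) m s i * stepProd β n s i) • mon q (n + i * s) (m - i * s)

theorem convLeft_geomTerm (q : kˣ) {s : ℕ} (hs : 0 < s) (β : ℤ → k) (n : ℤ) (m i : ℕ) :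
    convLeft (stepFunctional q s β) (geomTerm q s β n m i) =
      geomTerm q s β n m i - geomTerm q s β n m (i + 1) := by
  rw [geomTerm, map_smul, convLeft_mon q hs, smul_sub, geomTerm, qBinomProd, qBinomProd, stepProd,
    stepProd, Finset.prod_range_succ, Finset.prod_range_succ, smul_smul]
  congr 2
  · ring
  · rw [Nat.cast_add, Nat.cast_one]
    congr 1
    · ring
    · rw [add_mul, one_mul, Nat.sub_sub]

theorem convLeft_sum_geomTerm (q : kˣ) {s : ℕ} (hs : 0 < s) (β : ℤ → k) (n : ℤ) (m : ℕ) :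
    convLeft (stepFunctional q s β) (∑ i ∈ Finset.range (m / s + 1), geomTerm q s β n m i) =
      mon q n m := by
  rw [map_sum, Finset.sum_congr rfl fun i _ => convLeft_geomTerm q hs β n m i,
    Finset.sum_range_sub']
  -- the last factor of `qBinomProd` chooses `s` from the remainder of `m` modulo `s`
  have h0 : geomTerm q s β n m (m / s + 1) = 0 := by
    rw [geomTerm, qBinomProd, Finset.prod_range_succ, qBinom_eq_zero, mul_zero, zero_mul, zero_smul]
    rw [← Nat.mod_eq_sub_div_mul]
    exact Nat.mod_lt _ hs
  rw [h0, sub_zero]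
  simp [geomTerm, qBinomProd, stepProd]

/-- The prescribed value of `φ_β^{(s)}` is the inverse of `c ↦ v(c₁) c₂` applied to the value of
`c ↦ c₁ v(c₂)`. -/
theorem phiValue_eq (q : kˣ) {s : ℕ} (hs : 0 < s) (β : ℤ → k) (n : ℤ) (m : ℕ) :
    phiValue q s β n m = ∑ i ∈ Finset.range (m / s + 1), geomTerm q s β n m i -
      (qBinom (q : k) m s * β (n + m - s)) •
        ∑ i ∈ Finset.range ((m - s) / s + 1), geomTerm q s β n (m - s) i := by
  have hI : Finset.Icc 1 (m / s) = Finset.Ico 1 (m / s + 1) := rfl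
  rw [phiValue, hI, Finset.sum_Ico_eq_sum_range, Nat.add_sub_cancel, Finset.sum_range_succ',
    show geomTerm q s β n m 0 = mon q n m by simp [geomTerm, qBinomProd, stepProd],
    add_comm _ (mon q n m), add_sub_assoc (mon q n m)]
  congr 1
  simp only [smul_sub, Finset.sum_sub_distrib]
  congr 1
  · refine Finset.sum_congr rfl fun i _ => ?_
    rw [smul_smul, add_comm 1 i, geomTerm]
  · by_cases hm : s ≤ m
    · have hd : (m - s) / s + 1 = m / s := by
        rw [← Nat.add_div_right _ hs, Nat.sub_add_cancel hm]
      rw [hd, Finset.smul_sum]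
      refine Finset.sum_congr rfl fun i _ => ?_
      -- splitting off the factor with index `0`
      have hB : qBinomProd (q : k) m s (1 + i) =
          qBinom (q : k) m s * qBinomProd (q : k) (m - s) s i := by
        rw [add_comm, qBinomProd, Finset.prod_range_succ', mul_comm, qBinomProd, zero_mul,
          Nat.sub_zero]
        congr 1
        refine Finset.prod_congr rfl fun j _ => ?_
        rw [add_mul, one_mul, Nat.sub_sub, add_comm]
      rw [geomTerm, smul_smul, smul_smul, hB, Nat.add_sub_cancel_left]
      congr 1
      · ring
      · congr 1
        · push_cast; ring
        · rw [add_mul, one_mul, Nat.sub_sub]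
    · rw [Nat.div_eq_of_lt (not_le.1 hm), qBinom_eq_zero _ (not_le.1 hm)]
      simp

theorem convLeft_comp_monLift_phiValue {q : kˣ} (hq : ∀ n : ℕ, 0 < n → q ^ n ≠ 1) {s : ℕ}
    (hs : 0 < s) (β : ℤ → k) :
    convLeft (stepFunctional q s β) ∘ₗ monLift q (phiValue q s β) =
      convRight (stepFunctional q s β) := by
  refine linearMap_ext_mon q fun n m => ?_
  rw [LinearMap.comp_apply, monLift_mon, phiValue_eq q hs, map_sub, map_smul,
    convLeft_sum_geomTerm q hs, convLeft_sum_geomTerm q hs, convRight_mon hq hs]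

theorem phiValue_of_lt (q : kˣ) {s m : ℕ} (hm : m < s) (β : ℤ → k) (n : ℤ) :
    phiValue q s β n m = mon q n m := by
  simp [phiValue, Nat.div_eq_of_lt hm]

theorem phiValue_self (q : kˣ) {s : ℕ} (hs : 0 < s) (β : ℤ → k) (n : ℤ) :
    phiValue q s β n s = mon q n s + β n • (xpow q (n + s) - xpow q n) := by
  simp [phiValue, Nat.div_self hs, qBinomProd, stepProd, qBinom_self, mon_zero, smul_sub]

/-- The automorphism `φ_β^{(s)}`, as an element of `Aut_*(H)`. -/
def phiAut {q : kˣ} (hq : ∀ n : ℕ, 0 < n → q ^ n ≠ 1) (s : ℕ+) (β : ℤ → k) : autStar q :=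
  ⟨coinner (stepFunctional q s β) (bijective_convLeft q s.pos β) (bijective_convRight hq s.pos β)
    (monLift q (phiValue q s β)) (convLeft_comp_monLift_phiValue hq s.pos β), by
    refine ⟨?_, if (s : ℕ) = 1 then β else 0, fun n => ?_⟩
    · rw [← xpow_zero, ← mon_zero, coinner_apply, monLift_mon, phiValue_of_lt q s.pos]
    · rw [coinner_apply, monLift_mon]
      split_ifs with hs
      · rw [hs, phiValue_self q one_pos, Nat.cast_one]
      · have := s.pos
        rw [phiValue_of_lt q (by omega)]
        simp⟩

theorem phiAut_mon {q : kˣ} (hq : ∀ n : ℕ, 0 < n → q ^ n ≠ 1) (s : ℕ+) (β : ℤ → k) (n : ℤ)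
    (m : ℕ) : (phiAut hq s β).1 (mon q n m) = phiValue q s β n m :=
  monLift_mon q _ n m

/-! ### Comparing automorphisms degree by degree -/

/-- Two elements of `Aut_*(H)` take the same values at the monomials of degree less than `m`
in `y`. -/
def AgreeBelow {q : kˣ} (m : ℕ) (f g : autStar q) : Prop :=
  ∀ n, ∀ j < m, f.1 (mon q n j) = g.1 (mon q n j)

namespace AgreeBelow

variable {q : kˣ} {m m' : ℕ} {f g h : autStar q}

theorem symm (hfg : AgreeBelow m f g) : AgreeBelow m g f := fun n j hj => (hfg n j hj).symm

theorem trans (hfg : AgreeBelow m f g) (hgh : AgreeBelow m g h) : AgreeBelow m f h :=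
  fun n j hj => (hfg n j hj).trans (hgh n j hj)

theorem mono (hfg : AgreeBelow m f g) (hm : m' ≤ m) : AgreeBelow m' f g :=
  fun n j hj => hfg n j (hj.trans_le hm)

theorem apply_eq (hfg : AgreeBelow m f g) {v : H q} (hv : v ∈ degLT q m) : f.1 v = g.1 v :=
  degLT_le q (N := LinearMap.eqLocus (f.1 : H q →ₗ[k] H q) (g.1 : H q →ₗ[k] H q)) hfg hv

end AgreeBelow

theorem autStar_apply_xpow {q : kˣ} (f : autStar q) (n : ℤ) : f.1 (xpow q n) = xpow q n := by
  obtain ⟨f, h1, β, h⟩ := f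
  exact fixes_xpow q f h1 β h n

theorem autStar_ext {q : kˣ} {f g : autStar q} (h : ∀ n m, f.1 (mon q n m) = g.1 (mon q n m)) :
    f = g := by
  refine Subtype.ext (CoalgEquiv.ext fun v => ?_)
  obtain ⟨m, hm⟩ := exists_mem_degLT q v
  exact AgreeBelow.apply_eq (fun n j _ => h n j) hm

theorem mk_eq_mk_iff {q : kˣ} {i : ℕ} {f g : autStar q} :
    (QuotientGroup.mk f : autStar q ⧸ autFixStar q i) = QuotientGroup.mk g ↔
      AgreeBelow (i + 1) f g := by
  rw [QuotientGroup.eq, autFixStar, Subgroup.mem_subgroupOf, mem_autFix]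
  refine forall_congr' fun n => forall_congr' fun j => ?_
  rw [Nat.lt_succ_iff]
  refine forall_congr' fun _ => ?_
  change (f.1)⁻¹ (g.1 _) = _ ↔ _
  constructor
  · intro h
    have := congrArg f.1 h
    rw [show f.1 ((f.1)⁻¹ (g.1 (mon q n j))) = g.1 (mon q n j) from
      coalgAut_inv_apply_self (f.1)⁻¹ _] at this
    exact this.symm
  · intro h
    rw [← h]
    exact coalgAut_inv_apply_self f.1 _

section NotRootOfUnity

variable {q : kˣ} (hq : ∀ n : ℕ, 0 < n → q ^ n ≠ 1)
include hq

/-- If `u` fixes the monomials of degree at most `i`, then `u (xⁿ yⁱ⁺¹) - xⁿ yⁱ⁺¹` is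
skew-primitive, and hence a multiple of `xⁿ⁺ⁱ⁺¹ - xⁿ`. -/
theorem exists_apply_mon_succ (u : autStar q) {i : ℕ}
    (hu : AgreeBelow (i + 1) u 1) (n : ℤ) :
    ∃ c : k, u.1 (mon q n (i + 1)) =
      mon q n (i + 1) + c • (xpow q (n + (i + 1 : ℕ)) - xpow q n) := by
  rcases Nat.eq_zero_or_pos i with rfl | hi
  · obtain ⟨u, -, β, h⟩ := u
    exact ⟨β n, by simpa using h n⟩
  have hu' : ∀ n, ∀ j ≤ i, u.1 (mon q n j) = mon q n j := fun n j hj =>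
    hu n j (Nat.lt_succ_of_le hj)
  set d := u.1 (mon q n (i + 1)) - mon q n (i + 1) with hd
  have h : Coalgebra.comul (R := k) d =
      d ⊗ₜ[k] xpow q (n + (i + 1 : ℕ)) + xpow q n ⊗ₜ[k] d := by
    rw [hd, map_sub, comul_apply_mon, comul_mon, ← Finset.sum_sub_distrib,
      Finset.Nat.sum_antidiagonal_eq_sum_range_succ_mk, Finset.sum_range_succ,
      Finset.sum_range_succ', Finset.sum_eq_zero]
    · simp only [qBinom_self, qBinom_zero_right, one_smul, Nat.cast_zero, add_zero, Nat.sub_zero,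
        Nat.sub_self, mon_zero, autStar_apply_xpow, TensorProduct.sub_tmul, TensorProduct.tmul_sub]
      abel
    · intro j hj
      rw [Finset.mem_range] at hj
      rw [hu' _ (j + 1) (by omega), hu' _ (i + 1 - (j + 1)) (by omega), sub_self]
  obtain ⟨α, γ, e, hα⟩ := skewPrimitive_eq hq h
  refine ⟨γ, ?_⟩
  rw [hα (by push_cast; omega), zero_smul, zero_add] at e
  rw [← e, hd, add_sub_cancel]

theorem exists_apply_mon_succ_of_agree {f g : autStar q} {i : ℕ} (h : AgreeBelow (i + 1) f g)
    (n : ℤ) : ∃ c : k, f.1 (mon q n (i + 1)) =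
      g.1 (mon q n (i + 1)) + c • (xpow q (n + (i + 1 : ℕ)) - xpow q n) := by
  have hu : AgreeBelow (i + 1) (g⁻¹ * f) 1 := by
    intro n j hj
    change (g.1)⁻¹ (f.1 _) = _
    rw [h n j hj]
    exact coalgAut_inv_apply_self g.1 _
  obtain ⟨c, hc⟩ := exists_apply_mon_succ hq _ hu n
  refine ⟨c, ?_⟩
  have := congrArg g.1 hc
  rw [map_add, map_smul, map_sub, autStar_apply_xpow, autStar_apply_xpow] at this
  rw [← this]
  exact (coalgAut_inv_apply_self (g.1)⁻¹ _).symm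

/-! ### Ordered products of the `φ_β^{(s)}` -/

omit hq [Field k] in
theorem orderedProd_trunc_zero {M : Type*} [Monoid M] (φ : ℕ+ → (ℤ → k) → M) (β : GInf k) :
    orderedProd φ (β.trunc 0) = 1 := rfl

omit hq [Field k] in
theorem orderedProd_trunc_succ {M : Type*} [Monoid M] (φ : ℕ+ → (ℤ → k) → M) (β : GInf k)
    (i : ℕ) : orderedProd φ (β.trunc (i + 1)) =
      orderedProd φ (β.trunc i) * φ (Nat.succPNat i) (β.entry (Nat.succPNat i)) := by
  rw [orderedProd, orderedProd, List.ofFn_succ_last, List.prod_append, List.prod_singleton]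
  rfl

theorem mul_phiAut_apply_of_lt (f : autStar q) (i : ℕ) (β : ℤ → k) (n : ℤ) {j : ℕ}
    (hj : j < i + 1) :
    (f * phiAut hq (Nat.succPNat i) β).1 (mon q n j) = f.1 (mon q n j) := by
  change f.1 ((phiAut hq (Nat.succPNat i) β).1 _) = _
  rw [phiAut_mon, phiValue_of_lt q (by simpa using hj)]

theorem mul_phiAut_apply_self (f : autStar q) (i : ℕ) (β : ℤ → k) (n : ℤ) :
    (f * phiAut hq (Nat.succPNat i) β).1 (mon q n (i + 1)) =
      f.1 (mon q n (i + 1)) + β n • (xpow q (n + (i + 1 : ℕ)) - xpow q n) := by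
  change f.1 ((phiAut hq (Nat.succPNat i) β).1 _) = _
  rw [phiAut_mon, Nat.succPNat_coe, Nat.succ_eq_add_one, phiValue_self q (Nat.succ_pos i),
    map_add, map_smul, map_sub, autStar_apply_xpow, autStar_apply_xpow]

/-- Appending further factors to an ordered product does not change it in low degrees. -/
theorem orderedProd_agree (β : GInf k) {i j : ℕ} (hij : i ≤ j) :
    AgreeBelow (i + 1) (orderedProd (phiAut hq) (β.trunc j))
      (orderedProd (phiAut hq) (β.trunc i)) := by
  induction j, hij using Nat.le_induction with
  | base => exact fun _ _ _ => rfl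
  | succ j hij ih =>
    intro n l hl
    rw [orderedProd_trunc_succ, mul_phiAut_apply_of_lt hq _ _ _ _ (by omega)]
    exact ih n l hl

/-- Uniqueness of the factors: the `(i + 1)`-st is determined by the value at the `xⁿ yⁱ⁺¹` once the
preceding ones are known. -/
theorem trunc_eq_of_agree {β γ : GInf k} {i : ℕ}
    (h : AgreeBelow (i + 1) (orderedProd (phiAut hq) (β.trunc i))
      (orderedProd (phiAut hq) (γ.trunc i))) : β.trunc i = γ.trunc i := by
  induction i with
  | zero => exact congrArg GFin.mk (funext fun j => j.elim0)
  | succ i ih =>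
    have hi : β.trunc i = γ.trunc i := ih <| ((orderedProd_agree hq β (Nat.le_succ i)).symm.trans
      (h.mono (Nat.le_succ _))).trans (orderedProd_agree hq γ (Nat.le_succ i))
    have hl : β.entry (Nat.succPNat i) = γ.entry (Nat.succPNat i) := by
      funext n
      have := h n (i + 1) (Nat.lt_succ_self _)
      rw [orderedProd_trunc_succ, orderedProd_trunc_succ, mul_phiAut_apply_self,
        mul_phiAut_apply_self, hi] at this
      exact smul_xpow_sub_injective q (by omega) (add_left_cancel this)
    refine congrArg GFin.mk (funext fun j => ?_)
    refine Fin.lastCases ?_ (fun j => ?_) j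
    · exact hl
    · exact congrFun (congrArg GFin.entry hi) j

/-! ### Infinite ordered products -/

/-- The linear map underlying the infinite ordered product `φ^{(1)} φ^{(2)} ⋯`, which is finite on
each monomial. -/
def infProdLin (β : GInf k) : H q →ₗ[k] H q :=
  monLift q fun n m => (orderedProd (phiAut hq) (β.trunc m)).1 (mon q n m)

theorem infProdLin_mon (β : GInf k) (n : ℤ) (m : ℕ) : infProdLin hq β (mon q n m) =
    (orderedProd (phiAut hq) (β.trunc m)).1 (mon q n m) := monLift_mon q _ n m

theorem infProdLin_apply (β : GInf k) {m : ℕ} {v : H q} (hv : v ∈ degLT q (m + 1)) :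
    infProdLin hq β v = (orderedProd (phiAut hq) (β.trunc m)).1 v :=
  degLT_le q (N := LinearMap.eqLocus (infProdLin hq β)
    ((orderedProd (phiAut hq) (β.trunc m)).1 : H q →ₗ[k] H q))
    (fun n i hi => (infProdLin_mon hq β n i).trans
      (orderedProd_agree hq β (Nat.lt_succ_iff.1 hi) n i (Nat.lt_succ_self i)).symm) hv

omit hq in
theorem exists_mem_degLT_succ (v : H q) : ∃ m, v ∈ degLT q (m + 1) := by
  obtain ⟨m, hm⟩ := exists_mem_degLT q v
  exact ⟨m, degLT_mono q (Nat.le_succ m) hm⟩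

/-- The infinite ordered product is a coalgebra map, since it is locally given by one. -/
def infProdHom (β : GInf k) : H q →ₗc[k] H q :=
  { infProdLin hq β with
    counit_comp := by
      ext v
      obtain ⟨m, hm⟩ := exists_mem_degLT_succ v
      change Coalgebra.counit (infProdLin hq β v) = _
      rw [infProdLin_apply hq β hm, CoalgHomClass.counit_comp_apply]
    map_comp_comul := by
      refine linearMap_ext_mon q fun n m => ?_
      change TensorProduct.map (infProdLin hq β) (infProdLin hq β)
        (Coalgebra.comul (mon q n m)) = Coalgebra.comul (infProdLin hq β (mon q n m))
      rw [infProdLin_apply hq β (mon_mem_degLT q n (Nat.lt_succ_self m)), comul_apply_mon,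
        comul_mon, map_sum]
      refine Finset.sum_congr rfl fun p hp => ?_
      rw [Finset.HasAntidiagonal.mem_antidiagonal] at hp
      rw [map_smul, TensorProduct.map_tmul,
        infProdLin_apply hq β (m := m) (mon_mem_degLT q _ (by omega)),
        infProdLin_apply hq β (m := m) (mon_mem_degLT q _ (by omega))] }

theorem infProdHom_apply (β : GInf k) (v : H q) : infProdHom hq β v = infProdLin hq β v := rfl

theorem bijective_infProdHom (β : GInf k) : Function.Bijective (infProdHom hq β) := by
  constructor
  · rw [injective_iff_map_eq_zero]
    intro v hv
    obtain ⟨m, hm⟩ := exists_mem_degLT_succ v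
    rw [infProdHom_apply, infProdLin_apply hq β hm] at hv
    exact (EquivLike.injective (orderedProd (phiAut hq) (β.trunc m)).1)
      (hv.trans (map_zero _).symm)
  · intro v
    obtain ⟨m, hm⟩ := exists_mem_degLT_succ v
    refine ⟨((orderedProd (phiAut hq) (β.trunc m)).1)⁻¹ v, ?_⟩
    rw [infProdHom_apply, infProdLin_apply hq β (apply_mem_degLT hq _ hm)]
    exact coalgAut_inv_apply_self ((orderedProd (phiAut hq) (β.trunc m)).1)⁻¹ v

/-- The infinite ordered product `φ^{(1)} φ^{(2)} ⋯` as an element of `Aut_*(H)`. -/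
def infProd (β : GInf k) : autStar q :=
  ⟨CoalgEquiv.ofBijective (bijective_infProdHom hq β), by
    refine ⟨?_, β.entry 1, fun n => ?_⟩
    · change infProdLin hq β 1 = 1
      rw [← xpow_zero, infProdLin_apply hq β (m := 0) (xpow_mem_degLT q 0 one_pos),
        autStar_apply_xpow]
    · change infProdLin hq β (mon q n 1) = _
      rw [infProdLin_mon, orderedProd_trunc_succ]
      refine (mul_phiAut_apply_self hq _ 0 _ n).trans ?_
      rw [orderedProd_trunc_zero]
      simp only [zero_add, Nat.cast_one]
      rfl⟩

theorem infProd_apply (β : GInf k) (v : H q) : (infProd hq β).1 v = infProdLin hq β v := rfl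

theorem infProd_mon (β : GInf k) (n : ℤ) (m : ℕ) : (infProd hq β).1 (mon q n m) =
    (orderedProd (phiAut hq) (β.trunc m)).1 (mon q n m) := by
  rw [infProd_apply, infProdLin_mon]

theorem infProd_agree (β : GInf k) (i : ℕ) :
    AgreeBelow (i + 1) (infProd hq β) (orderedProd (phiAut hq) (β.trunc i)) := by
  intro n j hj
  rw [infProd_mon]
  exact (orderedProd_agree hq β (Nat.lt_succ_iff.1 hj) n j (Nat.lt_succ_self j)).symm

theorem infProd_mon_succ (β : GInf k) (n : ℤ) (i : ℕ) : (infProd hq β).1 (mon q n (i + 1)) =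
    (orderedProd (phiAut hq) (β.trunc i)).1 (mon q n (i + 1)) +
      β.entry (Nat.succPNat i) n • (xpow q (n + (i + 1 : ℕ)) - xpow q n) := by
  rw [infProd_mon, orderedProd_trunc_succ, mul_phiAut_apply_self]

/-- The scalars by which `f` and `g` differ at the monomials `xⁿ yⁱ⁺¹` if they agree in lower
degrees, read off at `xⁿ`. -/
def nextEntry (f g : autStar q) (i : ℕ) (n : ℤ) : k :=
  - coord q n 0 (f.1 (mon q n (i + 1)) - g.1 (mon q n (i + 1)))

/-- The finite ordered products approximating `f`. -/
def approx (f : autStar q) : ℕ → autStar q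
  | 0 => 1
  | i + 1 => approx f i * phiAut hq (Nat.succPNat i) (nextEntry f (approx f i) i)

/-- The sequence with infinite ordered product `f`. -/
def factors (f : autStar q) : GInf k :=
  ⟨fun s => nextEntry f (approx hq f s.natPred) s.natPred⟩

theorem agree_approx (f : autStar q) (i : ℕ) : AgreeBelow (i + 1) f (approx hq f i) := by
  induction i with
  | zero =>
    intro n j hj
    obtain rfl : j = 0 := by omega
    rw [mon_zero, autStar_apply_xpow, autStar_apply_xpow]
  | succ i ih =>
    intro n j hj
    rw [approx]
    rcases Nat.lt_succ_iff_lt_or_eq.1 hj with hj | rfl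
    · rw [mul_phiAut_apply_of_lt hq _ _ _ _ hj]
      exact ih n j hj
    · obtain ⟨c, hc⟩ := exists_apply_mon_succ_of_agree hq ih n
      have hne : n + ((i : ℤ) + 1) ≠ n := by omega
      rw [mul_phiAut_apply_self, nextEntry, hc]
      simp [coord_xpow, hne]

theorem orderedProd_factors (f : autStar q) (i : ℕ) :
    orderedProd (phiAut hq) ((factors hq f).trunc i) = approx hq f i := by
  induction i with
  | zero => rfl
  | succ i ih =>
    have e : (factors hq f).entry (Nat.succPNat i) = nextEntry f (approx hq f i) i := by
      change nextEntry f (approx hq f (Nat.succPNat i).natPred) (Nat.succPNat i).natPred = _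
      rw [Nat.natPred_succPNat]
    rw [orderedProd_trunc_succ, ih, e, approx]

theorem bijective_infProd : Function.Bijective (infProd hq) := by
  constructor
  · intro β γ h
    have ht : ∀ i, β.trunc i = γ.trunc i := fun i => by
      have hγ := infProd_agree hq γ i
      rw [← h] at hγ
      exact trunc_eq_of_agree hq ((infProd_agree hq β i).symm.trans hγ)
    refine congrArg GInf.mk (funext fun s => ?_)
    have := congrFun (congrArg GFin.entry (ht (s.natPred + 1))) (Fin.last _)
    simpa [GInf.trunc] using this
  · intro f
    refine ⟨factors hq f, autStar_ext fun n m => ?_⟩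
    rw [infProd_mon, orderedProd_factors]
    exact (agree_approx hq f m n m (Nat.lt_succ_self m)).symm

/-- The bijection `G_∞ → Aut_*(H)`. -/
def infProdEquiv : GInf k ≃ autStar q := Equiv.ofBijective _ (bijective_infProd hq)

omit hq in
theorem exists_trunc_eq {i : ℕ} (β : GFin k i) : ∃ γ : GInf k, γ.trunc i = β := by
  refine ⟨⟨fun s => if h : s.natPred < i then β.entry ⟨s.natPred, h⟩ else 0⟩, ?_⟩
  refine congrArg GFin.mk (funext fun j => ?_)
  simp

theorem mk_orderedProd_trunc (β : GInf k) (i : ℕ) :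
    (QuotientGroup.mk (orderedProd (phiAut hq) (β.trunc i)) : autStar q ⧸ autFixStar q i) =
      QuotientGroup.mk (infProd hq β) :=
  mk_eq_mk_iff.2 (infProd_agree hq β i).symm

theorem bijective_mk_orderedProd (i : ℕ) : Function.Bijective
    fun β : GFin k i => (QuotientGroup.mk (orderedProd (phiAut hq) β) :
      autStar q ⧸ autFixStar q i) := by
  constructor
  · intro β γ h
    obtain ⟨β, rfl⟩ := exists_trunc_eq β
    obtain ⟨γ, rfl⟩ := exists_trunc_eq γ
    exact trunc_eq_of_agree hq (mk_eq_mk_iff.1 h)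
  · intro f
    obtain ⟨f, rfl⟩ := QuotientGroup.mk_surjective f
    obtain ⟨β, rfl⟩ := (bijective_infProd hq).2 f
    exact ⟨β.trunc i, mk_orderedProd_trunc hq β i⟩

/-- The bijection `G_i → Aut_*(H) / Aut_i(H)`. -/
def finProdEquiv (i : ℕ) : GFin k i ≃ autStar q ⧸ autFixStar q i :=
  Equiv.ofBijective _ (bijective_mk_orderedProd hq i)

end NotRootOfUnity

theorem autFixStar_anti (q : kˣ) {i j : ℕ} (hij : i ≤ j) : autFixStar q j ≤ autFixStar q i := by
  intro f hf
  rw [autFixStar, Subgroup.mem_subgroupOf, mem_autFix] at hf ⊢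
  exact fun n l hl => hf n l (hl.trans hij)

omit [Field k] in
/-- A sequence is the same as a compatible system of finite tuples. -/
theorem bijective_trunc : Function.Bijective
    fun β : GInf k => (⟨fun i : ℕ+ => β.trunc i, fun _ _ _ => rfl⟩ :
      {g : ∀ i : ℕ+, GFin k i // ∀ i j : ℕ+, ∀ hij : i ≤ j, (g j).trunc hij = g i}) := by
  constructor
  · intro β γ h
    refine congrArg GInf.mk (funext fun s => ?_)
    have := congrFun (congrArg GFin.entry (congrFun (congrArg Subtype.val h)
      (Nat.succPNat s.natPred))) (Fin.last _)
    simpa [GInf.trunc] using this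
  · rintro ⟨g, hg⟩
    refine ⟨⟨fun s => (g (Nat.succPNat s.natPred)).entry (Fin.last _)⟩, Subtype.ext ?_⟩
    funext i
    refine congrArg GFin.mk (funext fun j => ?_)
    have hij : Nat.succPNat j ≤ i := by
      rw [← PNat.coe_le_coe]; exact j.2
    have := congrFun (congrArg GFin.entry (hg _ _ hij)) (Fin.last _)
    simp only [Nat.natPred_succPNat]
    exact this.symm

end QuantumBorel

end

/-! ### The structure of `Aut_*(H)` -/

open QuantumBorel

theorem theorem3p13 {k : Type*} [Field k] (q : kˣ) (hq : ∀ n : ℕ, 0 < n → q ^ n ≠ 1) :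
    -- `Aut_*(H)` is a normal subgroup of `Aut_c(H)`, and so is `Aut_i(H) ≤ Aut_*(H)` for `i ≥ 1`
    (autStar q).Normal ∧
    (∀ i : ℕ+, (autFix q i).Normal ∧ autFix q i ≤ autStar q) ∧
    ∃ (_ : ∀ i : ℕ+, (autFixStar q i).Normal)
      -- the automorphisms `φ_β^{(s)}`
      (φ : ℕ+ → (ℤ → k) → autStar q)
      (_ : ∀ (s : ℕ+) (β : ℤ → k) (n : ℤ) (m : ℕ), (φ s β).1 (mon q n m) = phiValue q s β n m)
      -- the group structures on the sets `G_i`, transported along the bijections `Φ_i`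
      (_ : ∀ i : ℕ+, Group (GFin k i))
      (Phi : ∀ i : ℕ+, GFin k i ≃* autStar q ⧸ autFixStar q i)
      (_ : ∀ (i : ℕ+) (β : GFin k i), Phi i β = QuotientGroup.mk (orderedProd φ β))
      -- the group morphisms `ψ_i^j`
      (psi : ∀ i j : ℕ+, i ≤ j → GFin k j →* GFin k i)
      (_ : ∀ (i j : ℕ+) (hij : i ≤ j) (β : GFin k j), psi i j hij β = β.trunc hij)
      -- the group structure on the set `G_∞`, transported along the bijection `τ`
      (_ : Group (GInf k))
      (tau : GInf k ≃* inverseLimit psi)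
      (_ : ∀ (β : GInf k) (i : ℕ+), (tau β).1 i = β.trunc i)
      -- the isomorphism
      (Iso : GInf k ≃* autStar q),
      (∀ (β : GInf k) (n : ℤ) (m : ℕ),
        (Iso β).1 (mon q n m) = (orderedProd φ (β.trunc m)).1 (mon q n m)) ∧
      -- the recursive description of the inverse isomorphism
      (∀ (f : autStar q) (i : ℕ) (n : ℤ),
        (Iso.symm f).entry (Nat.succPNat i) n • (xpow q (n + (i + 1 : ℕ)) - xpow q n) =
          f.1 (mon q n (i + 1)) -
            (orderedProd φ ((Iso.symm f).trunc i)).1 (mon q n (i + 1))) ∧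
      -- the recursive description of the multiplication of `G_∞`
      (∀ β γ : GInf k, (β * γ).entry 1 = β.entry 1 + γ.entry 1) ∧
      (∀ (β γ : GInf k) (i : ℕ) (n : ℤ),
        (β * γ).entry (Nat.succPNat i) n • (xpow q (n + (i + 1 : ℕ)) - xpow q n) =
          (orderedProd φ (β.trunc (i + 1)) * orderedProd φ (γ.trunc (i + 1))).1
              (mon q n (i + 1)) -
            (orderedProd φ ((β * γ).trunc i)).1 (mon q n (i + 1))) := by
  have hN : ∀ i : ℕ+, (autFixStar q i).Normal := fun i =>
    (normal_autFix hq i).subgroupOf (autStar q)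
  refine ⟨normal_autStar hq, fun i => ⟨normal_autFix hq i, autFix_le_autStar i.pos⟩, hN,
    phiAut hq, phiAut_mon hq, ?_⟩
  let grp : ∀ i : ℕ+, Group (GFin k i) := fun i => (finProdEquiv hq i).group
  let Phi : ∀ i : ℕ+, GFin k i ≃* autStar q ⧸ autFixStar q i := fun i =>
    (finProdEquiv hq i).mulEquiv
  let pr : ∀ i j : ℕ+, i ≤ j → autStar q ⧸ autFixStar q j →* autStar q ⧸ autFixStar q i :=
    fun i j hij => QuotientGroup.map (autFixStar q j) (autFixStar q i)
      (MonoidHom.id _) (autFixStar_anti q hij)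
  let psi : ∀ i j : ℕ+, i ≤ j → GFin k j →* GFin k i := fun i j hij =>
    (Phi i).symm.toMonoidHom.comp ((pr i j hij).comp (Phi j).toMonoidHom)
  let grpInf : Group (GInf k) := (infProdEquiv hq).group
  let Iso : GInf k ≃* autStar q := (infProdEquiv hq).mulEquiv
  have hPhi : ∀ (i : ℕ+) (β : GInf k), Phi i (β.trunc i) = QuotientGroup.mk (Iso β) :=
    fun i β => mk_orderedProd_trunc hq β i
  have hpsi : ∀ (i j : ℕ+) (hij : i ≤ j) (β : GFin k j), psi i j hij β = β.trunc hij := by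
    intro i j hij β
    obtain ⟨β, rfl⟩ := exists_trunc_eq β
    have h : psi i j hij (β.trunc j) = (Phi i).symm (pr i j hij (Phi j (β.trunc j))) := rfl
    have h' : (β.trunc j).trunc hij = β.trunc i := rfl
    rw [h, h', MulEquiv.symm_apply_eq, hPhi, hPhi]
    rfl
  -- both sides have the image of `Iso β * Iso γ` modulo `Aut_i(H)`
  have htrunc : ∀ (i : ℕ+) (β γ : GInf k), (β * γ).trunc i = β.trunc i * γ.trunc i := by
    intro i β γ
    apply (Phi i).injective
    rw [map_mul, hPhi, hPhi, hPhi, map_mul]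
    rfl
  let tauHom : GInf k →* inverseLimit psi := MonoidHom.mk'
    (fun β => ⟨fun i => β.trunc i, fun i j hij => hpsi i j hij _⟩)
    (fun β γ => Subtype.ext (funext fun i => htrunc i β γ))
  have htau : Function.Bijective tauHom := by
    constructor
    · intro β γ h
      have h' : (tauHom β).1 = (tauHom γ).1 := congrArg _ h
      exact bijective_trunc.1 (Subtype.ext h')
    · rintro ⟨g, hg⟩
      obtain ⟨β, hβ⟩ := bijective_trunc.2
        ⟨g, fun i j hij => (hpsi i j hij _).symm.trans (hg i j hij)⟩
      have hβ' : (fun i : ℕ+ => β.trunc i) = g := congrArg (fun x => x.1) hβ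
      exact ⟨β, Subtype.ext hβ'⟩
  have hIso : ∀ β, Iso β = infProd hq β := fun _ => rfl
  have hmul : ∀ (β γ : GInf k) (i : ℕ) (n : ℤ),
      (β * γ).entry (Nat.succPNat i) n • (xpow q (n + (i + 1 : ℕ)) - xpow q n) =
        (orderedProd (phiAut hq) (β.trunc (i + 1)) *
          orderedProd (phiAut hq) (γ.trunc (i + 1))).1 (mon q n (i + 1)) -
            (orderedProd (phiAut hq) ((β * γ).trunc i)).1 (mon q n (i + 1)) := by
    intro β γ i n
    have h : (Iso (β * γ)).1 (mon q n (i + 1)) =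
        (orderedProd (phiAut hq) (β.trunc (i + 1)) *
          orderedProd (phiAut hq) (γ.trunc (i + 1))).1 (mon q n (i + 1)) := by
      rw [map_mul]
      change (infProd hq β).1 ((infProd hq γ).1 _) = (orderedProd (phiAut hq) _).1
        ((orderedProd (phiAut hq) _).1 _)
      -- the inner product preserves the degree, so that the outer one may be truncated too
      rw [infProd_mon]
      exact (infProd_agree hq β (i + 1)).apply_eq (apply_mon_mem_degLT hq _ n (i + 1))
    rw [← h, hIso, infProd_mon_succ, add_sub_cancel_left]
  refine ⟨grp, Phi, fun _ _ => rfl, psi, hpsi, grpInf, MulEquiv.ofBijective tauHom htau,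
    fun _ _ => rfl, Iso, fun β n m => infProd_mon hq β n m, ?_, ?_, hmul⟩
  · intro f i n
    have h := infProd_mon_succ hq (Iso.symm f) n i
    rw [← hIso, MulEquiv.apply_symm_apply] at h
    rw [h, add_sub_cancel_left]
  · intro β γ
    have h1 : ∀ (β : GInf k) (n : ℤ), (infProd hq β).1 (mon q n 1) =
        mon q n 1 + β.entry 1 n • (xpow q (n + 1) - xpow q n) := fun β n =>
      (infProd_mon_succ hq β n 0).trans (by simp [orderedProd_trunc_zero]; rfl)
    funext n
    have h2 : (Iso (β * γ)).1 (mon q n 1) = (Iso β).1 ((Iso γ).1 (mon q n 1)) := by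
      rw [map_mul]; rfl
    rw [hIso, hIso, hIso, h1, h1, map_add, map_smul, map_sub, autStar_apply_xpow,
      autStar_apply_xpow, h1, add_assoc, ← add_smul] at h2
    rw [smul_xpow_sub_injective q (by omega) (add_left_cancel h2), Pi.add_apply]
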